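/- Let $d\ge 3$ be an odd integer, let $\mathbb{C}_\pm=\{z\in\mathbb{C}:\pm\operatorname{Im} z>0\}$ and let $dd^c=\frac{i}{\pi}\partial\overline\partial$, so that $dd^c u=\frac1{2\pi}\Delta u\,dx\,dy$. Let $\rho$ be the holomorphic function on $\mathbb{C}_+$ whose boundary values on $(0,1)$ are given by the same formula with real root and logarithm: $$\rho(z)=\log\frac{1+\sqrt{1-z^2}}{z}-\sqrt{1-z^2}.$$ Put $h_d(0)=h_d(\pi)=0$ and $$h_d(\theta)=\frac{4}{(d-2)!}\int_0^\infty\frac{\max(-\operatorname{Re}\rho(te^{i\theta}),0)}{t^{d+1}}\,dt\quad(0<\theta<\pi),$$ $$c_d=\frac{d}{2\pi}\int_0^\pi h_d(\theta)\,d\theta,\qquad e_d=\sqrt\pi\,\frac{\Gamma(\frac{d-1}{2})}{(d-2)!\,\Gamma(1+\frac d2)}.$$ Then the integrals defining $h_d$ and $c_d$ converge, $c_d>0$, and $h_d$ is of class $C^2$ on $(0,\pi)$, so that the following objects are well defined. For $z=re^{i\theta}$ with $r=|z|$ and $-\pi\le\theta\le\pi$, put $$H(z)=c_d^{-1}|z|^d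 h_d(|\theta|),\qquad H_Z(z)=\begin{cases}0,& z\in\mathbb{C}_+,\\ c_d^{-1}|z|^d h_d(|\theta|),& z\in\overline{\mathbb{C}_-}.\end{cases}$$ Let $\mu^-$ have density $$\kappa(z)=\frac{1}{2\pi c_d}\,r^{d-2}\big[d^2h_d(|\theta|)+h_d''(|\theta|)\big]$$ with respect to the Lebesgue measure of $\mathbb{C}$ on $\mathbb{C}_-$ and vanish elsewhere, let $\mu^+$ be the image of $\mu^-$ under $z\mapsto\overline z$, let $\mu^0$ be the measure carried by $\mathbb{R}$ with density $\frac{e_d}{2\pi c_d}|x|^{d-1}$ with respect to the Lebesgue measure of $\mathbb{R}$, and let $\mu_{\rm MZ}=\mu^0+\mu^-$. Then $H_Z$ and $H$ are subharmonic on $\mathbb{C}$. The density $\kappa$ is nonnegative on $\mathbb{C}_-$ and integrable on $K\cap\mathbb{C}_-$ for every compact $K\subset\mathbb{C}$, so that $\mu^-$, $\mu^+$, $\mu^0$ and $\mu_{\rm MZ}$ are locally finite positive measures on $\mathbb{C}$. In the sense of distributions on $\mathbb{C}$, $$dd^cH_Z=\mu^-+\mu^0=\mu_{\rm MZ},\qquad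 dd^cH=\mu^++\mu^-+2\mu^0.$$ In particular $dd^cH$ is a positive measure, and $\mu_{\rm MZ}$ is a positive measure with $\mu_{\rm MZ}(\mathbb{C}_+)=0$. -/

import Mathlib

open scoped Laplacian ContDiff

noncomputable section

namespace MelroseZworski

/-- The function `ρ(z) = log ((1 + √(1 - z²)) / z) - √(1 - z²)` on the open upper half-plane.
For `Im z > 0` neither `1 - z²` nor `(1 + √(1 - z²)) / z` lies on `(-∞, 0]`, so that with principal
branches this is the holomorphic function on the upper half-plane whose boundary values on `(0, 1)`
are given by the same formula with real root and logarithm. Only its values at points with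
`Im z > 0` are used. -/
def rho (z : ℂ) : ℂ :=
  Complex.log ((1 + (1 - z ^ 2) ^ (1 / 2 : ℂ)) / z) - (1 - z ^ 2) ^ (1 / 2 : ℂ)

/-- The integrand `max (-Re ρ(t e^{iθ}), 0) / t^{d+1}` in the definition of `h_d(θ)`. -/
def hIntegrand (d : ℕ) (θ t : ℝ) : ℝ :=
  max (-(rho ((t : ℂ) * Complex.exp (θ * Complex.I))).re) 0 / t ^ (d + 1)

open Classical in
/-- The function `h_d` on `[0, π]`, with `h_d(0) = h_d(π) = 0`. -/
def h (d : ℕ) (θ : ℝ) : ℝ :=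
  if 0 < θ ∧ θ < Real.pi then
    4 / (Nat.factorial (d - 2) : ℝ) * ∫ t in Set.Ioi (0 : ℝ), hIntegrand d θ t
  else 0

/-- The constant `c_d = (d / 2π) ∫₀^π h_d(θ) dθ`. -/
def c (d : ℕ) : ℝ :=
  (d : ℝ) / (2 * Real.pi) * ∫ θ in (0 : ℝ)..Real.pi, h d θ

/-- The constant `e_d = √π Γ((d-1)/2) / ((d-2)! Γ(1 + d/2))`. -/
def e (d : ℕ) : ℝ :=
  Real.sqrt Real.pi * Real.Gamma (((d : ℝ) - 1) / 2) /
    ((Nat.factorial (d - 2) : ℝ) * Real.Gamma (1 + (d : ℝ) / 2))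

/-- The open lower half-plane `ℂ₋`. -/
def lowerHalf : Set ℂ := {z | z.im < 0}

/-- The open upper half-plane `ℂ₊`. -/
def upperHalf : Set ℂ := {z | 0 < z.im}

/-- The density `κ(z) = (2π c_d)⁻¹ r^{d-2} (d² h_d(|θ|) + h_d''(|θ|))`, where `z = r e^{iθ}`. -/
def kappa (d : ℕ) (z : ℂ) : ℝ :=
  1 / (2 * Real.pi * c d) * ‖z‖ ^ (d - 2) *
    ((d : ℝ) ^ 2 * h d |z.arg| + deriv (deriv (h d)) |z.arg|)

/-- The measure `μ⁻` on `ℂ`: density `κ` on the open lower half-plane, zero elsewhere. -/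
def muMinus (d : ℕ) : MeasureTheory.Measure ℂ :=
  (MeasureTheory.volume.restrict lowerHalf).withDensity fun z => ENNReal.ofReal (kappa d z)

/-- The measure `μ⁺`, the image of `μ⁻` under complex conjugation. -/
def muPlus (d : ℕ) : MeasureTheory.Measure ℂ :=
  (muMinus d).map (starRingEnd ℂ)

/-- The measure `μ⁰` on `ℂ`, carried by the real line, with density `(e_d / (2π c_d)) |x|^{d-1}`
with respect to the Lebesgue measure of `ℝ`. -/
def muZero (d : ℕ) : MeasureTheory.Measure ℂ :=
  ((MeasureTheory.volume : MeasureTheory.Measure ℝ).withDensity fun x =>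
    ENNReal.ofReal (e d / (2 * Real.pi * c d) * |x| ^ (d - 1))).map ((↑) : ℝ → ℂ)

/-- The Melrose-Zworski distribution `μ_MZ = μ⁰ + μ⁻`. -/
def muMZ (d : ℕ) : MeasureTheory.Measure ℂ := muZero d + muMinus d

/-- `H(z) = c_d⁻¹ |z|^d h_d(|θ|)`, where `θ` is the argument of `z`. -/
def H (d : ℕ) (z : ℂ) : ℝ := (c d)⁻¹ * ‖z‖ ^ d * h d |z.arg|

open Classical in
/-- `H_Z` vanishes on the open upper half-plane and equals `c_d⁻¹ |z|^d h_d(|θ|)` on the closed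
lower half-plane. -/
def HZ (d : ℕ) (z : ℂ) : ℝ :=
  if 0 < z.im then 0 else (c d)⁻¹ * ‖z‖ ^ d * h d |z.arg|

/-- Subharmonicity on `ℂ` of a real-valued function: upper semicontinuity and the submean
inequality on every circle. (The mean of an upper semicontinuous function over a circle always
exists in `[-∞, ∞)`; for a finite-valued `u` the inequality forces it to be finite, so that
integrability is part of the definition.) -/
def IsSubharmonic (u : ℂ → ℝ) : Prop :=
  UpperSemicontinuous u ∧
    ∀ (a : ℂ) (r : ℝ), 0 < r → CircleIntegrable u a r ∧ u a ≤ Real.circleAverage u a r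

/-- `dd^c u = ν` in the sense of distributions on `ℂ`, for a locally integrable function `u` and a
locally finite positive measure `ν`. Here `dd^c = (i/π) ∂∂̄`, that is
`dd^c φ = (2π)⁻¹ Δφ dx dy`. -/
structure IsDdc (u : ℂ → ℝ) (ν : MeasureTheory.Measure ℂ) : Prop where
  locallyIntegrable : MeasureTheory.LocallyIntegrable u MeasureTheory.volume
  locallyFinite : MeasureTheory.IsLocallyFiniteMeasure ν
  integral_eq : ∀ φ : ℂ → ℝ, ContDiff ℝ ∞ φ → HasCompactSupport φ →
    ∫ z, u z * (1 / (2 * Real.pi) * (Δ φ) z) = ∫ z, φ z ∂ν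

end MelroseZworski

end

open Set Filter Topology MeasureTheory

namespace MelroseZworski

/-! ### The phase in logarithmic coordinates -/

/-! Write `z = exp ζ`, `ζ = l + iθ`, and `w = √(1 - z²)`. Up to an imaginary part `-ρ` becomes
`phase`, whose derivative in `ζ` is `w` (`hasStrictDerivAt_phase`). Since `Re w > 0`, on each ray
`-Re ρ` increases strictly with the modulus and changes sign once, at the radius `exp (logRadius
θ)`. So `h_d` is an integral over a half-line of `-Re ρ` itself, and integration by parts turns it
into an integral of `Re w`.

For odd `d = 2m + 3` the form `w z^{-d-1} dz` has a primitive that is a polynomial in `w / z`. This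
gives the closed form `h = (scale / d) Re T`, where `T = e^{idθ} tail` is evaluated on the zero
curve (`h_eq`). Along that curve `Re phase` is constant, so `w dζ` is purely imaginary, equal to `i
(|w|² / Re w) dθ`. Hence `T' = i (d T - q)` with `q = (|w|² / Re w) e^{-dl} ≥ 0`
(`hasDerivAt_twistedTail_curve`), and real and imaginary parts yield `h' = -scale Im T` and `d² h +
h'' = scale q ≥ 0`.

As `θ → 0` the curve tends to `z = 1`, where `w = 0`. There `q → 0`, because `|Im w| ≤ Re w` on the
curve (`root_im_sq_le`), and `T` tends to a purely imaginary Beta integral, so `h → 0` and `h' →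
e_d`. Reflection in the imaginary axis gives the limits at `π`.

In polar coordinates `|z|² Δ = (r ∂_r)² + ∂_θ²`. Testing `r^d h(θ)` on the upper half-plane, the
radial terms integrate to zero and Green's identity in `θ` leaves the density `d² h + h''` and the
boundary slopes `±e_d`, which are the mass on the real line (`setIntegral_upperHalf_green`).
Conjugation treats the lower half-plane: `H_Z` receives one copy of `μ⁰` and `H` two. Both functions
are continuous with positive distributional Laplacian, so mollification gives the submean inequality
(`IsDdc.isSubharmonic`). -/

/-- The square root `√(1 - z²)` in the logarithmic coordinate `z = exp ζ`. -/
noncomputable def root (ζ : ℂ) : ℂ := (1 - Complex.exp (2 * ζ)) ^ (1 / 2 : ℂ)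

/-- The function `-ρ` in the logarithmic coordinate, up to the imaginary part. -/
noncomputable def phase (ζ : ℂ) : ℂ := root ζ - Complex.log (1 + root ζ) + ζ

/-- The open set on which `root` is holomorphic. -/
def rootDomain : Set ℂ := {ζ | 1 - Complex.exp (2 * ζ) ∈ Complex.slitPlane}

/-- The point with polar angle `θ` and logarithm of the modulus `l`. -/
noncomputable def logPoint (l θ : ℝ) : ℂ := l + θ * Complex.I

@[simp] lemma logPoint_re (l θ : ℝ) : (logPoint l θ).re = l := by simp [logPoint]

@[simp] lemma logPoint_im (l θ : ℝ) : (logPoint l θ).im = θ := by simp [logPoint]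

/-- In the strip, `exp (2 * ζ)` is real only on the line `ζ.im = π / 2`, where it is negative; so `1
- exp (2 * ζ)` never meets the cut. -/
lemma mem_rootDomain_of_im {ζ : ℂ} (h0 : 0 < ζ.im) (h1 : ζ.im < Real.pi) : ζ ∈ rootDomain := by
  rw [rootDomain, mem_ofPred_eq, Complex.mem_slitPlane_iff]
  have hre : (Complex.exp (2 * ζ)).re = Real.exp (2 * ζ.re) * Real.cos (2 * ζ.im) := by
    simp [Complex.exp_re]
  have him : (Complex.exp (2 * ζ)).im = Real.exp (2 * ζ.re) * Real.sin (2 * ζ.im) := by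
    simp [Complex.exp_im]
  by_cases hs : Real.sin (2 * ζ.im) = 0
  · left
    have hsin : 0 < Real.sin ζ.im := Real.sin_pos_of_pos_of_lt_pi h0 h1
    have hcos : Real.cos ζ.im = 0 := by
      rw [Real.sin_two_mul] at hs
      rcases mul_eq_zero.mp hs with h | h
      · linarith
      · exact h
    have : Real.cos (2 * ζ.im) = -1 := by rw [Real.cos_two_mul, hcos]; norm_num
    rw [Complex.sub_re, hre, this, Complex.one_re]
    have := Real.exp_pos (2 * ζ.re)
    linarith
  · right
    rw [Complex.sub_im, him, Complex.one_im, zero_sub, neg_ne_zero]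
    exact mul_ne_zero (Real.exp_pos _).ne' hs

lemma mem_rootDomain_of_neg {l : ℝ} (hl : l < 0) : logPoint l 0 ∈ rootDomain := by
  rw [rootDomain, mem_ofPred_eq, Complex.mem_slitPlane_iff]
  left
  have : (Complex.exp (2 * logPoint l 0)).re = Real.exp (2 * l) := by
    simp [Complex.exp_re]
  rw [Complex.sub_re, this, Complex.one_re]
  have : Real.exp (2 * l) < 1 := by
    simpa using Real.exp_lt_exp.mpr (show 2 * l < 0 by linarith)
  linarith

lemma root_sq (ζ : ℂ) : root ζ ^ 2 = 1 - Complex.exp (2 * ζ) := by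
  have := Complex.cpow_ofNat_inv_pow (1 - Complex.exp (2 * ζ)) 2
  rw [root, one_div]
  exact this

lemma root_re_pos {ζ : ℂ} (h : ζ ∈ rootDomain) : 0 < (root ζ).re := by
  rw [root, one_div, Complex.cpow_inv_two_re]
  apply Real.sqrt_pos.mpr
  rw [rootDomain, mem_ofPred_eq, Complex.mem_slitPlane_iff] at h
  set w := 1 - Complex.exp (2 * ζ)
  have : -w.re < ‖w‖ := by
    rcases h with h | h
    · linarith [norm_nonneg w]
    · have := Complex.abs_re_lt_norm.mpr h
      linarith [neg_abs_le w.re]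
  linarith

lemma root_ne_zero {ζ : ℂ} (h : ζ ∈ rootDomain) : root ζ ≠ 0 := fun h0 => by
  have := root_re_pos h
  simp [h0] at this

lemma one_add_root_mem_slitPlane {ζ : ℂ} (h : ζ ∈ rootDomain) :
    1 + root ζ ∈ Complex.slitPlane := by
  rw [Complex.mem_slitPlane_iff]
  left
  have := root_re_pos h
  simp only [Complex.add_re, Complex.one_re]
  linarith

lemma hasStrictDerivAt_root {ζ : ℂ} (h : ζ ∈ rootDomain) :
    HasStrictDerivAt root (-Complex.exp (2 * ζ) / root ζ) ζ := by
  have h1 : HasStrictDerivAt (fun ζ : ℂ => 1 - Complex.exp (2 * ζ))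
      (-(Complex.exp (2 * ζ) * (2 * 1))) ζ :=
    (((hasStrictDerivAt_id ζ).const_mul 2).cexp).const_sub 1
  have h2 := h1.cpow_const (c := (1 / 2 : ℂ)) h
  convert! h2 using 1
  have hne : (1 - Complex.exp (2 * ζ)) ≠ 0 := Complex.slitPlane_ne_zero h
  rw [Complex.cpow_sub _ _ hne, Complex.cpow_one]
  change _ = 1 / 2 * (root ζ / (1 - Complex.exp (2 * ζ))) * _
  rw [← root_sq]
  field_simp [root_ne_zero h]

/-- With `w = root ζ` one has `w w' = -exp (2ζ) = w² - 1`, so `w' (1 - 1 / (1 + w)) + 1 = w w' / (1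
+ w) + 1 = w`. Strictness is what the implicit function theorem needs later. -/
lemma hasStrictDerivAt_phase {ζ : ℂ} (h : ζ ∈ rootDomain) :
    HasStrictDerivAt phase (root ζ) ζ := by
  have hr := hasStrictDerivAt_root h
  have hl := (hr.const_add 1).clog (one_add_root_mem_slitPlane h)
  convert! (hr.sub hl).add (hasStrictDerivAt_id ζ) using 1
  have h0 := root_ne_zero h
  have h1 := Complex.slitPlane_ne_zero (one_add_root_mem_slitPlane h)
  have : Complex.exp (2 * ζ) = 1 - root ζ ^ 2 := by rw [root_sq]; ring
  rw [this]
  field_simp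
  ring

lemma phase_re (ζ : ℂ) : (phase ζ).re = (root ζ).re - Real.log ‖1 + root ζ‖ + ζ.re := by
  simp [phase, Complex.log_re]

lemma ofReal_mul_exp_eq {t θ : ℝ} (ht : 0 < t) :
    (t : ℂ) * Complex.exp (θ * Complex.I) = Complex.exp (logPoint (Real.log t) θ) := by
  rw [logPoint, Complex.exp_add, ← Complex.ofReal_exp, Real.exp_log ht]

/-- Only moduli enter the real part of a logarithm, so the quotient inside `rho` splits with no
question of branches. -/
lemma rho_exp_re {ζ : ℂ} (h : ζ ∈ rootDomain) :
    (rho (Complex.exp ζ)).re = -(phase ζ).re := by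
  have hz : 1 - Complex.exp ζ ^ 2 = 1 - Complex.exp (2 * ζ) := by
    rw [← Complex.exp_nat_mul]; norm_num
  have h1 := Complex.slitPlane_ne_zero (one_add_root_mem_slitPlane h)
  rw [rho, hz, phase_re]
  change (Complex.log ((1 + root ζ) / Complex.exp ζ) - root ζ).re = _
  rw [Complex.sub_re, Complex.log_re, norm_div, Real.log_div (norm_ne_zero_iff.mpr h1)
    (norm_ne_zero_iff.mpr (Complex.exp_ne_zero _)), Complex.norm_exp, Real.log_exp]
  ring

/-! ### Size and sector estimates for the square root -/

lemma norm_one_sub_mul_one_add_root (ζ : ℂ) :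
    ‖1 - root ζ‖ * ‖1 + root ζ‖ = Real.exp (2 * ζ.re) := by
  rw [← norm_mul]
  have : (1 - root ζ) * (1 + root ζ) = Complex.exp (2 * ζ) := by
    have := root_sq ζ
    linear_combination -this
  rw [this, Complex.norm_exp]
  simp

lemma norm_root_sq_le (ζ : ℂ) : ‖root ζ‖ ^ 2 ≤ 1 + Real.exp ζ.re ^ 2 := by
  rw [← norm_pow, root_sq]
  refine (norm_sub_le _ _).trans ?_
  rw [Complex.norm_exp, ← Real.exp_nat_mul]
  simp

lemma norm_root_le (ζ : ℂ) : ‖root ζ‖ ≤ 1 + Real.exp ζ.re := by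
  have h := norm_root_sq_le ζ
  have := Real.exp_pos ζ.re
  nlinarith [norm_nonneg (root ζ)]

/-- From `(Re w)² = (|w²| + Re w²) / 2` and `|1 - z²| ≥ |z|² - 1`, the right side is at least `|z|²
(1 - cos 2θ) / 2 = |z|² sin² θ`. This gives growth of the phase on rays and the asymptotics `w ~
-iz`. -/
lemma exp_mul_sin_le_root_re (ζ : ℂ) :
    Real.exp ζ.re * Real.sin ζ.im ≤ (root ζ).re := by
  rw [root, one_div, Complex.cpow_inv_two_re]
  apply Real.le_sqrt_of_sq_le
  set E := Real.exp ζ.re with hE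
  have hn : E ^ 2 - 1 ≤ ‖1 - Complex.exp (2 * ζ)‖ := by
    have h1 := norm_sub_norm_le (Complex.exp (2 * ζ)) 1
    rw [norm_sub_rev, Complex.norm_exp, norm_one] at h1
    have : (2 * ζ).re = (2 : ℕ) * ζ.re := by simp
    rwa [this, Real.exp_nat_mul] at h1
  have hre : (1 - Complex.exp (2 * ζ)).re = 1 - E ^ 2 * Real.cos (2 * ζ.im) := by
    rw [Complex.sub_re, Complex.one_re, Complex.exp_re, hE, ← Real.exp_nat_mul]
    simp
  rw [hre, Real.cos_two_mul]
  nlinarith [Real.sin_sq_add_cos_sq ζ.im]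

/-- The difference of the two sides vanishes at `0` and has derivative `x² / 2 * cosh x`. At `x = 2
Re w` the inequality is exactly the sector bound for `w` on the zero curve. -/
lemma mul_cosh_le (x : ℝ) (hx : 0 ≤ x) :
    x * Real.cosh x ≤ (1 + x ^ 2 / 2) * Real.sinh x := by
  have hd : ∀ y : ℝ, HasDerivAt (fun y => (1 + y ^ 2 / 2) * Real.sinh y - y * Real.cosh y)
      (y ^ 2 / 2 * Real.cosh y) y := fun y => by
    have h1 : HasDerivAt (fun y : ℝ => 1 + y ^ 2 / 2) (2 * y / 2) y := by
      simpa using ((hasDerivAt_pow 2 y).div_const 2).const_add 1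
    convert! (h1.mul (Real.hasDerivAt_sinh y)).sub
      ((hasDerivAt_id y).mul (Real.hasDerivAt_cosh y)) using 1
    simp only [id]
    ring
  have hm : Monotone (fun y : ℝ => (1 + y ^ 2 / 2) * Real.sinh y - y * Real.cosh y) := by
    apply monotone_of_deriv_nonneg (fun y => (hd y).differentiableAt)
    intro y
    rw [(hd y).deriv]
    have := Real.cosh_pos y
    positivity
  have := hm hx
  simp at this
  linarith

/-- On the curve where the phase is purely imaginary the square root stays in the sector
`|arg| ≤ π / 4`. -/
lemma root_im_sq_le {ζ : ℂ} (h : ζ ∈ rootDomain) (h0 : (phase ζ).re = 0) :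
    (root ζ).im ^ 2 ≤ (root ζ).re ^ 2 := by
  have ha := root_re_pos h
  have h1 := norm_pos_iff.mpr (Complex.slitPlane_ne_zero (one_add_root_mem_slitPlane h))
  have hprod := norm_one_sub_mul_one_add_root ζ
  rw [phase_re] at h0
  set a := (root ζ).re with ha'
  set b := (root ζ).im with hb'
  set l := ζ.re
  -- Vanishing of `Re phase` fixes `|1 + w| = e^l e^a`, and `(1 - w)(1 + w) = e^{2ζ}` then fixes `|1
  -- - w| = e^l e^{-a}`. Sum and difference of the squares are `e1` and `e2`; eliminating `e^{2l}`
  -- leaves `sinh 2a (1 + a² + b²) = 2a cosh 2a`.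
  have hp : ‖1 + root ζ‖ = Real.exp l * Real.exp a := by
    rw [← Real.exp_log h1, ← Real.exp_add]
    congr 1
    linarith
  have hm : ‖1 - root ζ‖ = Real.exp l * Real.exp (-a) := by
    rw [hp] at hprod
    have : Real.exp (2 * l) = Real.exp l * Real.exp l := by rw [← Real.exp_add]; ring_nf
    rw [this] at hprod
    have hinv : Real.exp (-a) * Real.exp a = 1 := by rw [← Real.exp_add]; simp
    have hpos : Real.exp l * Real.exp a ≠ 0 := by positivity
    apply mul_right_cancel₀ hpos
    rw [hprod]
    linear_combination -(Real.exp l * Real.exp l) * hinv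
  have hp2 : (1 + a) ^ 2 + b ^ 2 = (Real.exp l * Real.exp a) ^ 2 := by
    rw [← hp, ← Complex.normSq_eq_norm_sq, Complex.normSq_apply]
    simp; ring
  have hm2 : (1 - a) ^ 2 + b ^ 2 = (Real.exp l * Real.exp (-a)) ^ 2 := by
    rw [← hm, ← Complex.normSq_eq_norm_sq, Complex.normSq_apply]
    simp; ring
  have hc : Real.cosh (2 * a) = (Real.exp a ^ 2 + Real.exp (-a) ^ 2) / 2 := by
    rw [Real.cosh_eq, ← Real.exp_nat_mul, ← Real.exp_nat_mul]; simp
  have hs : Real.sinh (2 * a) = (Real.exp a ^ 2 - Real.exp (-a) ^ 2) / 2 := by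
    rw [Real.sinh_eq, ← Real.exp_nat_mul, ← Real.exp_nat_mul]; simp
  have e1 : 2 * a = Real.exp l ^ 2 * Real.sinh (2 * a) := by
    rw [hs]; linear_combination (hp2 - hm2) / 2
  have e2 : 1 + a ^ 2 + b ^ 2 = Real.exp l ^ 2 * Real.cosh (2 * a) := by
    rw [hc]; linear_combination (hp2 + hm2) / 2
  have hspos : 0 < Real.sinh (2 * a) := Real.sinh_pos_iff.mpr (by linarith)
  have key := mul_cosh_le (2 * a) (by linarith)
  have : Real.sinh (2 * a) * b ^ 2 ≤ Real.sinh (2 * a) * a ^ 2 := by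
    have : Real.sinh (2 * a) * (1 + a ^ 2 + b ^ 2) = 2 * a * Real.cosh (2 * a) := by
      rw [e2]
      nth_rw 3 [e1]
      ring
    nlinarith
  exact le_of_mul_le_mul_left this hspos

/-- The sector bound says `Re w² ≥ 0`, and `w² = 1 - e^{2ζ}`. This bounds the radius of the curve
from above near the real axis. -/
lemma exp_sq_mul_cos_le {ζ : ℂ} (h : ζ ∈ rootDomain) (h0 : (phase ζ).re = 0) :
    Real.exp ζ.re ^ 2 * Real.cos (2 * ζ.im) ≤ 1 := by
  have h1 := root_im_sq_le h h0
  have h2 := congrArg Complex.re (root_sq ζ)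
  rw [sq, Complex.mul_re, Complex.sub_re, Complex.one_re, Complex.exp_re] at h2
  have h3 : Real.exp (2 * ζ).re = Real.exp ζ.re ^ 2 := by rw [← Real.exp_nat_mul]; simp
  have h4 : (2 * ζ).im = 2 * ζ.im := by simp
  rw [h3, h4] at h2
  nlinarith

/-- On `0 < z < 1` the root is a real `a` in `(0, 1)` and the phase is `a - artanh a`. -/
lemma phase_re_neg_of_neg {l : ℝ} (hl : l < 0) : (phase (logPoint l 0)).re < 0 := by
  have hmem := mem_rootDomain_of_neg hl
  have ha := root_re_pos hmem
  have hreal : (root (logPoint l 0)).im = 0 := by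
    have h2 := congrArg Complex.im (root_sq (logPoint l 0))
    rw [sq, Complex.mul_im, Complex.sub_im, Complex.one_im, Complex.exp_im] at h2
    simp at h2
    rcases mul_eq_zero.mp (by linarith : (root (logPoint l 0)).re * (root (logPoint l 0)).im = 0)
      with h | h
    · linarith
    · exact h
  set a := (root (logPoint l 0)).re with ha'
  have hroot : root (logPoint l 0) = a := by
    apply Complex.ext <;> simp [ha', hreal]
  have hsq : a ^ 2 = 1 - Real.exp (2 * l) := by
    have h2 := congrArg Complex.re (root_sq (logPoint l 0))
    rw [hroot, Complex.sub_re, Complex.one_re, Complex.exp_re, ← Complex.ofReal_pow,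
      Complex.ofReal_re] at h2
    simpa using h2
  have ha1 : a < 1 := by nlinarith [Real.exp_pos (2 * l)]
  have hlog : 2 * a < Real.log (1 + a) - Real.log (1 - a) := by
    have hs := Real.hasSum_log_sub_log_of_abs_lt_one (x := a)
      (by rw [abs_lt]; constructor <;> linarith)
    -- The second term of the series, `2a³ / 3`, supplies the strict inequality.
    have := sum_le_hasSum (Finset.range 2) (fun i _ => by positivity) hs
    rw [Finset.sum_range_succ, Finset.sum_range_one] at this
    norm_num at this
    have : 0 < a ^ 3 := by positivity
    linarith
  have hl2 : 2 * l = Real.log (1 + a) + Real.log (1 - a) := by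
    rw [← Real.log_mul (by linarith) (by linarith), ← Real.log_exp (2 * l)]
    congr 1
    linarith
  rw [phase_re, hroot, Complex.ofReal_re, logPoint_re]
  have : ‖(1 : ℂ) + a‖ = 1 + a := by
    rw [← Complex.ofReal_one, ← Complex.ofReal_add, Complex.norm_real, Real.norm_of_nonneg]
    linarith
  rw [this]
  linarith

/-! ### The zero curve of the phase -/

lemma hasDerivAt_logPoint (l θ : ℝ) : HasDerivAt (fun l => logPoint l θ) 1 l := by
  simpa [logPoint] using (Complex.ofRealCLM.hasDerivAt (x := l)).add_const (θ * Complex.I)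

lemma hasDerivAt_phase_re {θ : ℝ} (hθ : θ ∈ Ioo 0 Real.pi) (l : ℝ) :
    HasDerivAt (fun l => (phase (logPoint l θ)).re) (root (logPoint l θ)).re l := by
  have hm : logPoint l θ ∈ rootDomain := mem_rootDomain_of_im (by simpa using hθ.1)
    (by simpa using hθ.2)
  have := (hasStrictDerivAt_phase hm).hasDerivAt.comp l (hasDerivAt_logPoint l θ)
  rw [mul_one] at this
  exact (Complex.reCLM.hasFDerivAt.comp_hasDerivAt l this)

lemma logPoint_mem_rootDomain {θ : ℝ} (hθ : θ ∈ Ioo 0 Real.pi) (l : ℝ) :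
    logPoint l θ ∈ rootDomain :=
  mem_rootDomain_of_im (by simpa using hθ.1) (by simpa using hθ.2)

lemma strictMono_phase_re {θ : ℝ} (hθ : θ ∈ Ioo 0 Real.pi) :
    StrictMono fun l => (phase (logPoint l θ)).re := by
  apply strictMono_of_deriv_pos
  intro l
  rw [(hasDerivAt_phase_re hθ l).deriv]
  exact root_re_pos (logPoint_mem_rootDomain hθ l)

lemma exists_phase_re_eq_zero {θ : ℝ} (hθ : θ ∈ Ioo 0 Real.pi) :
    ∃ l, (phase (logPoint l θ)).re = 0 := by
  have hcont : Continuous fun l => (phase (logPoint l θ)).re :=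
    continuous_iff_continuousAt.mpr fun l => (hasDerivAt_phase_re hθ l).continuousAt
  apply mem_range_of_exists_le_of_exists_ge hcont
  -- Here `|w| ≤ 1 + e^{-2} ≤ 2` and the logarithm is nonnegative, so the real part is at most `2 -
  -- 2`.
  · refine ⟨-2, ?_⟩
    rw [phase_re, logPoint_re]
    have h1 := norm_root_le (logPoint (-2) θ)
    have h2 := Complex.re_le_norm (root (logPoint (-2) θ))
    have h3 : Real.exp (logPoint (-2) θ).re ≤ 1 := by rw [logPoint_re]; simp
    have h4 := root_re_pos (logPoint_mem_rootDomain hθ (-2))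
    have h5 : 0 ≤ Real.log ‖1 + root (logPoint (-2) θ)‖ := by
      apply Real.log_nonneg
      refine le_trans ?_ (Complex.re_le_norm _)
      simp only [Complex.add_re, Complex.one_re]
      linarith
    linarith
  · have hs := Real.sin_pos_of_pos_of_lt_pi hθ.1 hθ.2
    -- This choice makes `Re w ≥ e^l sin θ ≥ 2 ≥ log 3`, while `log |1 + w| ≤ log 3 + l`.
    set l := 2 / Real.sin θ with hl
    have hl0 : 0 < l := by positivity
    refine ⟨l, ?_⟩
    rw [phase_re, logPoint_re]
    have h1 := exp_mul_sin_le_root_re (logPoint l θ)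
    have h2 := norm_root_le (logPoint l θ)
    rw [logPoint_re, logPoint_im] at h1
    rw [logPoint_re] at h2
    have h3 : 1 ≤ Real.exp l := Real.one_le_exp hl0.le
    have h4 : 2 ≤ Real.exp l * Real.sin θ := by
      have := Real.add_one_le_exp l
      have h5 : l * Real.sin θ = 2 := by rw [hl]; field_simp
      nlinarith
    have h5 : ‖1 + root (logPoint l θ)‖ ≤ 3 * Real.exp l := by
      refine (norm_add_le _ _).trans ?_
      rw [norm_one]; linarith
    have h6 : Real.log ‖1 + root (logPoint l θ)‖ ≤ Real.log 3 + l := by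
      rw [← Real.log_exp l, ← Real.log_mul (by norm_num) (Real.exp_pos _).ne', Real.log_exp]
      exact Real.log_le_log (norm_pos_iff.mpr (Complex.slitPlane_ne_zero
        (one_add_root_mem_slitPlane (logPoint_mem_rootDomain hθ l)))) h5
    have h7 : Real.log 3 ≤ 2 := by
      have := Real.log_le_sub_one_of_pos (show (0 : ℝ) < 3 by norm_num)
      linarith
    linarith

/-- The logarithm of the radius at which the ray of angle `θ` meets the zero curve of the phase. -/
noncomputable def logRadius (θ : ℝ) : ℝ :=
  Classical.epsilon fun l => (phase (logPoint l θ)).re = 0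

/-- The zero curve of the phase, in the logarithmic coordinate. -/
noncomputable def curve (θ : ℝ) : ℂ := logPoint (logRadius θ) θ

lemma phase_curve_re {θ : ℝ} (hθ : θ ∈ Ioo 0 Real.pi) : (phase (curve θ)).re = 0 :=
  Classical.epsilon_spec (exists_phase_re_eq_zero hθ)

@[simp] lemma curve_re (θ : ℝ) : (curve θ).re = logRadius θ := logPoint_re _ _

@[simp] lemma curve_im (θ : ℝ) : (curve θ).im = θ := logPoint_im _ _

lemma curve_mem_rootDomain {θ : ℝ} (hθ : θ ∈ Ioo 0 Real.pi) : curve θ ∈ rootDomain :=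
  logPoint_mem_rootDomain hθ _

lemma eq_logRadius {θ l : ℝ} (hθ : θ ∈ Ioo 0 Real.pi) (h : (phase (logPoint l θ)).re = 0) :
    l = logRadius θ :=
  (strictMono_phase_re hθ).injective (h.trans (phase_curve_re hθ).symm)

lemma phase_re_pos_iff {θ l : ℝ} (hθ : θ ∈ Ioo 0 Real.pi) :
    0 < (phase (logPoint l θ)).re ↔ logRadius θ < l := by
  rw [← phase_curve_re hθ]
  exact (strictMono_phase_re hθ).lt_iff_lt

lemma hasDerivAt_curve_of {θ D : ℝ} (h : HasDerivAt logRadius D θ) :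
    HasDerivAt curve (D + Complex.I) θ := by
  have e1 := Complex.ofRealCLM.hasFDerivAt.comp_hasDerivAt θ h
  have e2 := (Complex.ofRealCLM.hasDerivAt (x := θ)).mul_const Complex.I
  convert! e1.add e2 using 1
  simp

/-- The implicit function theorem applies because the derivative of `Re phase` in `l` is `Re w > 0`;
strict monotonicity identifies the implicit function with `logRadius`. Differentiating `Re phase =
0` along the curve gives `Re (w (D + i)) = 0`, which determines the slope `D`. -/
lemma hasDerivAt_logRadius {θ : ℝ} (hθ : θ ∈ Ioo 0 Real.pi) :
    HasDerivAt logRadius ((root (curve θ)).im / (root (curve θ)).re) θ := by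
  set ℓ : ℝ × ℝ →L[ℝ] ℂ := Complex.ofRealCLM.comp (ContinuousLinearMap.snd ℝ ℝ ℝ) +
    (Complex.ofRealCLM.comp (ContinuousLinearMap.fst ℝ ℝ ℝ)).smulRight Complex.I with hℓ
  have hℓe : ∀ p : ℝ × ℝ, ℓ p = logPoint p.2 p.1 := fun p => by simp [hℓ, logPoint]
  have hm := curve_mem_rootDomain hθ
  have ha := root_re_pos hm
  have hb : ℓ (θ, logRadius θ) = curve θ := hℓe _
  have h1 : HasStrictFDerivAt phase ((ContinuousLinearMap.toSpanSingleton ℂ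
      (root (curve θ))).restrictScalars ℝ) (ℓ (θ, logRadius θ)) := by
    rw [hb]
    exact (hasStrictDerivAt_phase hm).hasStrictFDerivAt.restrictScalars ℝ
  have h2 := Complex.reCLM.hasStrictFDerivAt.comp (θ, logRadius θ)
    (h1.comp (θ, logRadius θ) ℓ.hasStrictFDerivAt)
  set f' := Complex.reCLM ∘L ((ContinuousLinearMap.toSpanSingleton ℂ
      (root (curve θ))).restrictScalars ℝ) ∘L ℓ with hf'
  have hinv : (f' ∘L ContinuousLinearMap.inr ℝ ℝ ℝ).IsInvertible := by
    refine ⟨ContinuousLinearEquiv.unitsEquivAut ℝ (Units.mk0 _ ha.ne'), ?_⟩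
    ext
    simp [hf', hℓ]
  have hψ := h2.hasStrictFDerivAt_implicitFunctionOfProdDomain hinv
  have hev := h2.eventually_apply_implicitFunctionOfProdDomain hinv
  set ψ := h2.implicitFunctionOfProdDomain hinv
  have heq : ψ =ᶠ[𝓝 θ] logRadius := by
    filter_upwards [hev, isOpen_Ioo.mem_nhds hθ] with x hx hx'
    apply eq_logRadius hx'
    have : (phase (ℓ (x, ψ x))).re = (phase (ℓ (θ, logRadius θ))).re := hx
    rwa [hb, phase_curve_re hθ, hℓe] at this
  have hd : DifferentiableAt ℝ logRadius θ :=
    (hψ.hasFDerivAt.congr_of_eventuallyEq heq.symm).differentiableAt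
  have hD := hd.hasDerivAt
  have hc := hasDerivAt_curve_of hD
  have hp := Complex.reCLM.hasFDerivAt.comp_hasDerivAt θ
    ((hasStrictDerivAt_phase hm).hasDerivAt.comp θ hc)
  have hz : (Complex.reCLM ∘ phase ∘ curve) =ᶠ[𝓝 θ] fun _ => 0 := by
    filter_upwards [isOpen_Ioo.mem_nhds hθ] with x hx
    exact phase_curve_re hx
  have h0 := hp.unique ((hasDerivAt_const θ (0 : ℝ)).congr_of_eventuallyEq hz)
  simp at h0
  have : deriv logRadius θ = (root (curve θ)).im / (root (curve θ)).re := by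
    rw [eq_div_iff ha.ne']
    linarith
  rwa [this] at hD

lemma hasDerivAt_curve {θ : ℝ} (hθ : θ ∈ Ioo 0 Real.pi) :
    HasDerivAt curve (((root (curve θ)).im / (root (curve θ)).re : ℝ) + Complex.I) θ :=
  hasDerivAt_curve_of (hasDerivAt_logRadius hθ)

/-! ### Primitives -/

/-- The primitive of `w² (1 + w²)^m` vanishing at the origin. -/
noncomputable def primitive (m : ℕ) (w : ℂ) : ℂ :=
  ∑ k ∈ Finset.range (m + 1), (m.choose k : ℂ) * (w ^ (2 * k + 3) / (2 * k + 3))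

lemma hasDerivAt_primitive (m : ℕ) (w : ℂ) :
    HasDerivAt (primitive m) (w ^ 2 * (1 + w ^ 2) ^ m) w := by
  have h : HasDerivAt (primitive m) (∑ k ∈ Finset.range (m + 1),
      (m.choose k : ℂ) * (((2 * k + 3 : ℕ) : ℂ) * w ^ (2 * k + 3 - 1) / (2 * k + 3))) w := by
    refine HasDerivAt.fun_sum fun k _ => ?_
    exact ((hasDerivAt_pow (2 * k + 3) w).div_const _).const_mul _
  convert! h using 1
  rw [add_comm 1, add_pow, Finset.mul_sum]
  refine Finset.sum_congr rfl fun k _ => ?_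
  have : (2 * (k : ℂ) + 3) ≠ 0 := by exact_mod_cast (by omega : 2 * k + 3 ≠ 0)
  have e : 2 * k + 3 - 1 = 2 * k + 2 := by omega
  rw [e]
  push_cast
  field_simp
  ring

/-- The integral of `√(1 - z²) z^{-(2 m + 4)}` from `exp ζ` to infinity. -/
noncomputable def tail (m : ℕ) (ζ : ℂ) : ℂ :=
  primitive m (root ζ * Complex.exp (-ζ)) - primitive m (-Complex.I)

/-- For `s = w e^{-ζ}` one has `1 + s² = e^{-2ζ}` and `s s' = -e^{-2ζ}`, so `s² (1 + s²)^m s' = -w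
e^{-(2m+3)ζ}`. Oddness of `d` enters here: it makes the exponent `m` an integer and the primitive a
polynomial. -/
lemma hasDerivAt_tail (m : ℕ) {ζ : ℂ} (h : ζ ∈ rootDomain) :
    HasDerivAt (tail m) (-(root ζ * Complex.exp (-((2 * m + 3 : ℕ) * ζ)))) ζ := by
  have h1 := (hasStrictDerivAt_root h).hasDerivAt.mul (hasDerivAt_neg ζ).cexp
  have h2 := ((hasDerivAt_primitive m _).comp ζ h1).sub_const (primitive m (-Complex.I))
  convert! h2 using 1
  have h0 := root_ne_zero h
  have e1 : 1 + (root ζ * Complex.exp (-ζ)) ^ 2 = Complex.exp (-ζ) ^ 2 := by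
    rw [mul_pow, root_sq, sub_mul, two_mul, Complex.exp_add]
    have : Complex.exp ζ * Complex.exp (-ζ) = 1 := by rw [← Complex.exp_add]; simp
    linear_combination -(1 + Complex.exp ζ * Complex.exp (-ζ)) * this
  have e2 : Complex.exp (-((2 * m + 3 : ℕ) * ζ)) = Complex.exp (-ζ) ^ (2 * m + 3) := by
    rw [← Complex.exp_nat_mul]; ring_nf
  have e3 : Complex.exp (2 * ζ) = 1 - root ζ ^ 2 := by rw [root_sq]; ring
  rw [Pi.mul_apply, e1, e2, e3]
  field_simp
  ring

/-- Since `(w + iz)(w - iz) = w² + z² = 1`, we have `w / z + i = 1 / (z (w - iz))`, and `Re (w - iz)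
= Re w + Im z ≥ 2 |z| sin θ`. Hence `w / z → -i` along rays, which is why `tail` subtracts
`primitive m (-I)`. -/
lemma norm_root_mul_exp_neg_add_I_le {ζ : ℂ} (h0 : 0 < ζ.im) (h1 : ζ.im < Real.pi) :
    ‖root ζ * Complex.exp (-ζ) + Complex.I‖ ≤ (2 * Real.exp ζ.re ^ 2 * Real.sin ζ.im)⁻¹ := by
  have hs := Real.sin_pos_of_pos_of_lt_pi h0 h1
  have hr := exp_mul_sin_le_root_re ζ
  set z := Complex.exp ζ with hz
  have hzi : Complex.exp (-ζ) = z⁻¹ := Complex.exp_neg ζ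
  have hz0 : z ≠ 0 := Complex.exp_ne_zero _
  have hzn : ‖z‖ = Real.exp ζ.re := Complex.norm_exp ζ
  have him : z.im = Real.exp ζ.re * Real.sin ζ.im := Complex.exp_im ζ
  have hre : 2 * (Real.exp ζ.re * Real.sin ζ.im) ≤ ‖root ζ - Complex.I * z‖ := by
    refine le_trans ?_ (Complex.re_le_norm _)
    simp [him]
    linarith
  have hpos : 0 < ‖root ζ - Complex.I * z‖ := lt_of_lt_of_le (by positivity) hre
  have hne : root ζ - Complex.I * z ≠ 0 := norm_pos_iff.mp hpos
  have e : root ζ * z⁻¹ + Complex.I = (z * (root ζ - Complex.I * z))⁻¹ := by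
    have hsq : root ζ ^ 2 = 1 - z ^ 2 := by
      rw [root_sq, hz, ← Complex.exp_nat_mul]; norm_num
    apply eq_inv_of_mul_eq_one_left
    linear_combination hsq - z ^ 2 * Complex.I_sq +
      (root ζ * (root ζ - Complex.I * z)) * inv_mul_cancel₀ hz0
  rw [hzi, e, norm_inv, norm_mul, hzn]
  apply inv_anti₀ (by positivity)
  nlinarith [Real.exp_pos ζ.re]

lemma tendsto_tail_atTop (m : ℕ) {θ : ℝ} (hθ : θ ∈ Ioo 0 Real.pi) :
    Tendsto (fun l => tail m (logPoint l θ)) atTop (𝓝 0) := by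
  have hs := Real.sin_pos_of_pos_of_lt_pi hθ.1 hθ.2
  have h1 : Tendsto (fun l => root (logPoint l θ) * Complex.exp (-logPoint l θ)) atTop
      (𝓝 (-Complex.I)) := by
    rw [tendsto_iff_norm_sub_tendsto_zero]
    have hlim : Tendsto (fun l => (2 * Real.exp l ^ 2 * Real.sin θ)⁻¹) atTop (𝓝 0) := by
      apply Tendsto.inv_tendsto_atTop
      apply Tendsto.atTop_mul_const hs
      apply Tendsto.const_mul_atTop (by norm_num)
      exact (tendsto_pow_atTop (by norm_num)).comp Real.tendsto_exp_atTop
    refine squeeze_zero (fun _ => norm_nonneg _) (fun l => ?_) hlim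
    have := norm_root_mul_exp_neg_add_I_le (ζ := logPoint l θ) (by simpa using hθ.1)
      (by simpa using hθ.2)
    simpa using this
  have h2 := ((hasDerivAt_primitive m (-Complex.I)).continuousAt.tendsto.comp h1).sub_const
    (primitive m (-Complex.I))
  simpa [tail, Function.comp_def] using h2

/-- The factor `e^{i d θ}` times the tail integral, at the point with logarithmic coordinate `ζ`. -/
noncomputable def twistedTail (m : ℕ) (ζ : ℂ) : ℂ :=
  Complex.exp ((2 * m + 3 : ℕ) * ζ.im * Complex.I) * tail m ζ

/-- The rotation makes `e^{-nζ}` real, so taking real parts of the twisted tail acts on `w` alone.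
-/
lemma exp_im_mul_exp_neg (n : ℕ) (ζ : ℂ) :
    Complex.exp (n * ζ.im * Complex.I) * Complex.exp (-(n * ζ)) = (Real.exp (-(n * ζ.re)) : ℝ) := by
  rw [← Complex.exp_add, Complex.ofReal_exp]
  congr 1
  push_cast
  nth_rw 2 [← Complex.re_add_im ζ]
  ring

lemma hasDerivAt_twistedTail_re (m : ℕ) {θ : ℝ} (hθ : θ ∈ Ioo 0 Real.pi) (l : ℝ) :
    HasDerivAt (fun l => (twistedTail m (logPoint l θ)).re)
      (-((root (logPoint l θ)).re * Real.exp (-((2 * m + 3 : ℕ) * l)))) l := by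
  have h1 := ((hasDerivAt_tail m (logPoint_mem_rootDomain hθ l)).comp l
    (hasDerivAt_logPoint l θ)).const_mul (Complex.exp ((2 * m + 3 : ℕ) * θ * Complex.I))
  have h2 := Complex.reCLM.hasFDerivAt.comp_hasDerivAt l h1
  convert! h2 using 1
  · ext l; simp [twistedTail]
  · have := exp_im_mul_exp_neg (2 * m + 3) (logPoint l θ)
    rw [logPoint_im, logPoint_re] at this
    rw [mul_one, mul_neg, mul_left_comm, this, Complex.reCLM_apply,
      Complex.neg_re, Complex.re_mul_ofReal]

/-! ### The closed form of `h` -/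

lemma hIntegrand_eq (d : ℕ) {θ t : ℝ} (hθ : θ ∈ Ioo 0 Real.pi) (ht : 0 < t) :
    hIntegrand d θ t = max (phase (logPoint (Real.log t) θ)).re 0 / t ^ (d + 1) := by
  rw [hIntegrand, ofReal_mul_exp_eq ht, rho_exp_re (logPoint_mem_rootDomain hθ _), neg_neg]

/-- A primitive of the integrand of `h` beyond the zero curve. -/
noncomputable def hPrimitive (m : ℕ) (θ t : ℝ) : ℝ :=
  -(((phase (logPoint (Real.log t) θ)).re / t ^ (2 * m + 3) +
    (twistedTail m (logPoint (Real.log t) θ)).re) / (2 * m + 3 : ℕ))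

/-- Integration by parts: the term `Re w / t^{d+1}` from differentiating the phase cancels against
the derivative of the twisted tail, leaving `-d Re phase / t^{d+1}` before the division by `-d`. -/
lemma hasDerivAt_hPrimitive (m : ℕ) {θ t : ℝ} (hθ : θ ∈ Ioo 0 Real.pi) (ht : 0 < t) :
    HasDerivAt (hPrimitive m θ)
      ((phase (logPoint (Real.log t) θ)).re / t ^ (2 * m + 3 + 1)) t := by
  have hl := Real.hasDerivAt_log ht.ne'
  have h1 := (hasDerivAt_phase_re hθ (Real.log t)).comp t hl
  have h2 := (hasDerivAt_twistedTail_re m hθ (Real.log t)).comp t hl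
  have h3 := ((h1.div (hasDerivAt_pow (2 * m + 3) t) (by positivity)).add h2).div_const
    ((2 * m + 3 : ℕ) : ℝ)
  convert! h3.neg using 1
  have e : Real.exp (-((2 * m + 3 : ℕ) * Real.log t)) = (t ^ (2 * m + 3))⁻¹ := by
    rw [Real.exp_neg, Real.exp_nat_mul, Real.exp_log ht]
  rw [e]
  have hd : ((2 * m + 3 : ℕ) : ℝ) ≠ 0 := by positivity
  have e2 : 2 * m + 3 - 1 = 2 * m + 2 := by omega
  rw [e2]
  simp only [Function.comp]
  field_simp
  ring

lemma hPrimitive_exp_logRadius (m : ℕ) {θ : ℝ} (hθ : θ ∈ Ioo 0 Real.pi) :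
    hPrimitive m θ (Real.exp (logRadius θ)) =
      -((twistedTail m (curve θ)).re / (2 * m + 3 : ℕ)) := by
  rw [hPrimitive, Real.log_exp]
  change -(((phase (curve θ)).re / _ + (twistedTail m (curve θ)).re) / _) = _
  rw [phase_curve_re hθ]
  simp

lemma phase_re_le {θ l : ℝ} (hθ : θ ∈ Ioo 0 Real.pi) :
    (phase (logPoint l θ)).re ≤ 1 + 2 * Real.exp l := by
  rw [phase_re, logPoint_re]
  have h1 := norm_root_le (logPoint l θ)
  rw [logPoint_re] at h1
  have h2 := Complex.re_le_norm (root (logPoint l θ))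
  have h4 := root_re_pos (logPoint_mem_rootDomain hθ l)
  have h5 : 0 ≤ Real.log ‖1 + root (logPoint l θ)‖ := by
    apply Real.log_nonneg
    refine le_trans ?_ (Complex.re_le_norm _)
    simp only [Complex.add_re, Complex.one_re]
    linarith
  have := Real.add_one_le_exp l
  linarith

lemma tendsto_hPrimitive_atTop (m : ℕ) {θ : ℝ} (hθ : θ ∈ Ioo 0 Real.pi) :
    Tendsto (hPrimitive m θ) atTop (𝓝 0) := by
  have h1 : Tendsto (fun t : ℝ => (phase (logPoint (Real.log t) θ)).re / t ^ (2 * m + 3)) atTop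
      (𝓝 0) := by
    have hb : Tendsto (fun t : ℝ => 3 * t⁻¹) atTop (𝓝 0) := by
      simpa using tendsto_inv_atTop_zero.const_mul (3 : ℝ)
    refine squeeze_zero' ?_ ?_ hb
    · filter_upwards [eventually_gt_atTop (Real.exp (logRadius θ))] with t ht
      have ht0 : 0 < t := (Real.exp_pos _).trans ht
      have := (phase_re_pos_iff hθ).mpr ((Real.lt_log_iff_exp_lt ht0).mpr ht)
      positivity
    · filter_upwards [eventually_ge_atTop 1] with t ht
      have ht0 : 0 < t := by linarith
      have h2 := phase_re_le (l := Real.log t) hθ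
      rw [Real.exp_log ht0] at h2
      rw [div_le_iff₀ (by positivity)]
      have h3 : t ^ 2 ≤ t ^ (2 * m + 3) := pow_le_pow_right₀ ht (by omega)
      calc _ ≤ 3 * t := by linarith
        _ = 3 * t⁻¹ * t ^ 2 := by field_simp
        _ ≤ _ := by gcongr
  have h2 : Tendsto (fun t : ℝ => (twistedTail m (logPoint (Real.log t) θ)).re) atTop (𝓝 0) := by
    have h3 := ((tendsto_tail_atTop m hθ).const_mul
      (Complex.exp ((2 * m + 3 : ℕ) * θ * Complex.I))).comp Real.tendsto_log_atTop
    have h4 := (Complex.continuous_re.tendsto _).comp h3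
    simpa [twistedTail, Function.comp_def] using h4
  have := ((h1.add h2).div_const ((2 * m + 3 : ℕ) : ℝ)).neg
  rwa [add_zero, zero_div, neg_zero] at this

/-- Beyond the zero radius the integrand is a positive derivative of a function with a limit, so
integrability and value come together. At the zero radius only the twisted tail survives. -/
lemma integrableOn_Ioi_hIntegrand (m : ℕ) {θ : ℝ} (hθ : θ ∈ Ioo 0 Real.pi) :
    IntegrableOn (hIntegrand (2 * m + 3) θ) (Ioi (Real.exp (logRadius θ))) ∧
    ∫ t in Ioi (Real.exp (logRadius θ)), hIntegrand (2 * m + 3) θ t =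
      (twistedTail m (curve θ)).re / (2 * m + 3 : ℕ) := by
  have hpos : ∀ t ∈ Ioi (Real.exp (logRadius θ)),
      0 < (phase (logPoint (Real.log t) θ)).re / t ^ (2 * m + 3 + 1) := fun t ht => by
    have ht0 : 0 < t := (Real.exp_pos _).trans ht
    have := (phase_re_pos_iff hθ).mpr ((Real.lt_log_iff_exp_lt ht0).mpr ht)
    positivity
  have heq : EqOn (fun t => (phase (logPoint (Real.log t) θ)).re / t ^ (2 * m + 3 + 1))
      (hIntegrand (2 * m + 3) θ) (Ioi (Real.exp (logRadius θ))) := fun t ht => by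
    have ht0 : 0 < t := (Real.exp_pos _).trans ht
    have := (phase_re_pos_iff hθ).mpr ((Real.lt_log_iff_exp_lt ht0).mpr ht)
    simp only
    rw [hIntegrand_eq _ hθ ht0, max_eq_left this.le]
  have hd : ∀ t ∈ Ici (Real.exp (logRadius θ)), HasDerivAt (hPrimitive m θ)
      ((phase (logPoint (Real.log t) θ)).re / t ^ (2 * m + 3 + 1)) t := fun t ht =>
    hasDerivAt_hPrimitive m hθ ((Real.exp_pos _).trans_le ht)
  constructor
  · exact (integrableOn_Ioi_deriv_of_nonneg' hd (fun t ht => (hpos t ht).le)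
      (tendsto_hPrimitive_atTop m hθ)).congr_fun heq measurableSet_Ioi
  · rw [← setIntegral_congr_fun measurableSet_Ioi heq,
      integral_Ioi_of_hasDerivAt_of_nonneg' hd (fun t ht => (hpos t ht).le)
      (tendsto_hPrimitive_atTop m hθ), hPrimitive_exp_logRadius m hθ]
    simp

lemma hIntegrand_eq_zero (d : ℕ) {θ t : ℝ} (hθ : θ ∈ Ioo 0 Real.pi) (ht : 0 < t)
    (ht' : t ≤ Real.exp (logRadius θ)) : hIntegrand d θ t = 0 := by
  rw [hIntegrand_eq _ hθ ht, max_eq_right, zero_div]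
  rw [← not_lt, phase_re_pos_iff hθ, not_lt]
  exact (Real.log_le_iff_le_exp ht).mpr ht'

lemma integrableOn_hIntegrand (m : ℕ) {θ : ℝ} (hθ : θ ∈ Ioo 0 Real.pi) :
    IntegrableOn (hIntegrand (2 * m + 3) θ) (Ioi 0) := by
  rw [← Ioc_union_Ioi_eq_Ioi (Real.exp_pos (logRadius θ)).le]
  refine IntegrableOn.union ?_ (integrableOn_Ioi_hIntegrand m hθ).1
  refine integrableOn_zero.congr_fun (fun t ht => ?_) measurableSet_Ioc
  exact (hIntegrand_eq_zero _ hθ ht.1 ht.2).symm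

/-- The constant `4 / (d - 2)!` for `d = 2 m + 3`. -/
noncomputable def scale (m : ℕ) : ℝ := 4 / (Nat.factorial (2 * m + 3 - 2) : ℝ)

lemma scale_pos (m : ℕ) : 0 < scale m := by
  unfold scale
  positivity

lemma h_eq_mul_integral (m : ℕ) {θ : ℝ} (hθ : θ ∈ Ioo 0 Real.pi) :
    h (2 * m + 3) θ =
      scale m * ∫ t in Ioi (Real.exp (logRadius θ)), hIntegrand (2 * m + 3) θ t := by
  rw [h, if_pos (mem_Ioo.mp hθ), setIntegral_eq_of_subset_of_forall_sdiff_eq_zero measurableSet_Ioi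
    (Ioi_subset_Ioi (Real.exp_pos (logRadius θ)).le)
    (fun t ht => hIntegrand_eq_zero _ hθ ht.1 (not_lt.mp ht.2)), scale]

lemma h_eq (m : ℕ) {θ : ℝ} (hθ : θ ∈ Ioo 0 Real.pi) :
    h (2 * m + 3) θ = scale m / (2 * m + 3 : ℕ) * (twistedTail m (curve θ)).re := by
  rw [h_eq_mul_integral m hθ, (integrableOn_Ioi_hIntegrand m hθ).2]
  ring

lemma h_pos (m : ℕ) {θ : ℝ} (hθ : θ ∈ Ioo 0 Real.pi) : 0 < h (2 * m + 3) θ := by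
  rw [h_eq_mul_integral m hθ]
  have hpos : ∀ t ∈ Ioi (Real.exp (logRadius θ)), 0 < hIntegrand (2 * m + 3) θ t := fun t ht => by
    have ht0 : 0 < t := (Real.exp_pos _).trans ht
    have := (phase_re_pos_iff hθ).mpr ((Real.lt_log_iff_exp_lt ht0).mpr ht)
    rw [hIntegrand_eq _ hθ ht0, max_eq_left this.le]
    positivity
  have : 0 < ∫ t in Ioi (Real.exp (logRadius θ)), hIntegrand (2 * m + 3) θ t := by
    rw [setIntegral_pos_iff_support_of_nonneg_ae
      ((ae_restrict_mem measurableSet_Ioi).mono fun t ht => (hpos t ht).le)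
      (integrableOn_Ioi_hIntegrand m hθ).1]
    have : Function.support (hIntegrand (2 * m + 3) θ) ∩ Ioi (Real.exp (logRadius θ)) =
        Ioi (Real.exp (logRadius θ)) := inter_eq_right.mpr fun t ht => (hpos t ht).ne'
    rw [this, Real.volume_Ioi]
    exact ENNReal.zero_lt_top
  exact mul_pos (scale_pos m) this

lemma h_eq_zero (d : ℕ) {θ : ℝ} (hθ : θ ∉ Ioo 0 Real.pi) : h d θ = 0 := by
  exact if_neg hθ

/-! ### Derivatives of `h` -/

/-- The derivative of `h` on `(0, π)`. -/
noncomputable def slope (m : ℕ) (θ : ℝ) : ℝ := -(scale m * (twistedTail m (curve θ)).im)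

/-- The function `d² h + h''` on `(0, π)`. -/
noncomputable def angular (m : ℕ) (θ : ℝ) : ℝ :=
  scale m * (Complex.normSq (root (curve θ)) / (root (curve θ)).re *
    Real.exp (-((2 * m + 3 : ℕ) * logRadius θ)))

/-- The tangent `D + i` of the curve satisfies `w (D + i) = i |w|² / Re w`, and the rotation makes
`e^{-dζ}` real. So the tail contributes `-iq` with `q` real, and the rotating factor contributes
`id` times the twisted tail. -/
lemma hasDerivAt_twistedTail_curve (m : ℕ) {θ : ℝ} (hθ : θ ∈ Ioo 0 Real.pi) :
    HasDerivAt (fun θ => twistedTail m (curve θ))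
      (((2 * m + 3 : ℕ) * twistedTail m (curve θ) -
        (Complex.normSq (root (curve θ)) / (root (curve θ)).re *
          Real.exp (-((2 * m + 3 : ℕ) * logRadius θ)) : ℝ)) * Complex.I) θ := by
  have hm := curve_mem_rootDomain hθ
  have ha := root_re_pos hm
  have h1 := (hasDerivAt_tail m hm).comp θ (hasDerivAt_curve hθ)
  have h2 : HasDerivAt (fun θ : ℝ => Complex.exp ((2 * m + 3 : ℕ) * θ * Complex.I))
      (Complex.exp ((2 * m + 3 : ℕ) * θ * Complex.I) * ((2 * m + 3 : ℕ) * 1 * Complex.I)) θ :=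
    (((Complex.ofRealCLM.hasDerivAt (x := θ)).const_mul ((2 * m + 3 : ℕ) : ℂ)).mul_const
      Complex.I).cexp
  convert! h2.mul h1 using 1
  · ext θ; simp [twistedTail]
  · have e1 := exp_im_mul_exp_neg (2 * m + 3) (curve θ)
    rw [curve_im, curve_re] at e1
    have e2 : root (curve θ) * (((root (curve θ)).im / (root (curve θ)).re : ℝ) + Complex.I) =
        (Complex.normSq (root (curve θ)) / (root (curve θ)).re : ℝ) * Complex.I := by
      rw [Complex.normSq_apply]
      apply Complex.ext
      · simp [Complex.mul_re]
        field_simp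
        ring
      · simp [Complex.mul_im]
        field_simp
    rw [Complex.ofReal_mul, ← e1, twistedTail, curve_im, Function.comp]
    linear_combination Complex.exp ((2 * m + 3 : ℕ) * θ * Complex.I) *
      Complex.exp (-((2 * m + 3 : ℕ) * curve θ)) * e2

lemma hasDerivAt_h (m : ℕ) {θ : ℝ} (hθ : θ ∈ Ioo 0 Real.pi) :
    HasDerivAt (h (2 * m + 3)) (slope m θ) θ := by
  have h1 := (Complex.reCLM.hasFDerivAt.comp_hasDerivAt θ
    (hasDerivAt_twistedTail_curve m hθ)).const_mul (scale m / (2 * m + 3 : ℕ))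
  have h2 : h (2 * m + 3) =ᶠ[𝓝 θ] fun θ =>
      scale m / (2 * m + 3 : ℕ) * (twistedTail m (curve θ)).re := by
    filter_upwards [isOpen_Ioo.mem_nhds hθ] with x hx using h_eq m hx
  have h3 := HasDerivAt.congr_of_eventuallyEq h1 h2
  convert! h3 using 1
  simp only [slope, Complex.reCLM_apply, Complex.mul_re, Complex.I_re, Complex.I_im, mul_zero,
    mul_one, zero_sub, Complex.sub_im, Complex.ofReal_im, sub_zero, Complex.natCast_im, zero_mul,
    add_zero, Complex.mul_im, Complex.natCast_re]
  have : ((2 * m + 3 : ℕ) : ℝ) ≠ 0 := by positivity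
  field_simp

/-- Imaginary part of the first-order equation `T' = i (d T - q)`, whose real part gives
`hasDerivAt_h`; together they are the second-order equation for `h`. -/
lemma hasDerivAt_slope (m : ℕ) {θ : ℝ} (hθ : θ ∈ Ioo 0 Real.pi) :
    HasDerivAt (slope m) (angular m θ - ((2 * m + 3 : ℕ) : ℝ) ^ 2 * h (2 * m + 3) θ) θ := by
  have h1 := ((Complex.imCLM.hasFDerivAt.comp_hasDerivAt θ
    (hasDerivAt_twistedTail_curve m hθ)).const_mul (scale m)).neg
  convert! h1 using 1
  rw [h_eq m hθ, angular]
  simp only [Complex.imCLM_apply, Complex.mul_re, Complex.I_re, Complex.I_im, mul_zero,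
    mul_one, Complex.sub_re, Complex.ofReal_re, sub_zero, Complex.natCast_im, zero_mul,
    add_zero, Complex.mul_im, Complex.natCast_re]
  have : ((2 * m + 3 : ℕ) : ℝ) ≠ 0 := by positivity
  field_simp
  ring

lemma continuousOn_root_curve : ContinuousOn (fun θ => root (curve θ)) (Ioo 0 Real.pi) :=
  fun _ hθ => ((hasStrictDerivAt_root (curve_mem_rootDomain hθ)).hasDerivAt.continuousAt.comp
    (hasDerivAt_curve hθ).continuousAt).continuousWithinAt

lemma continuousOn_angular (m : ℕ) : ContinuousOn (angular m) (Ioo 0 Real.pi) := by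
  have h1 := continuousOn_root_curve
  have h2 : ContinuousOn logRadius (Ioo 0 Real.pi) := fun _ hθ =>
    (hasDerivAt_logRadius hθ).continuousAt.continuousWithinAt
  refine ContinuousOn.mul continuousOn_const (ContinuousOn.mul (ContinuousOn.div ?_ ?_ ?_) ?_)
  · exact Complex.continuous_normSq.comp_continuousOn h1
  · exact Complex.continuous_re.comp_continuousOn h1
  · exact fun θ hθ => (root_re_pos (curve_mem_rootDomain hθ)).ne'
  · exact Real.continuous_exp.comp_continuousOn ((continuousOn_const.mul h2).neg)

lemma angular_nonneg (m : ℕ) {θ : ℝ} (hθ : θ ∈ Ioo 0 Real.pi) : 0 ≤ angular m θ := by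
  have h1 := root_re_pos (curve_mem_rootDomain hθ)
  have h2 := scale_pos m
  have h3 := Complex.normSq_nonneg (root (curve θ))
  unfold angular
  positivity

lemma deriv_deriv_h (m : ℕ) {θ : ℝ} (hθ : θ ∈ Ioo 0 Real.pi) :
    ((2 * m + 3 : ℕ) : ℝ) ^ 2 * h (2 * m + 3) θ + deriv (deriv (h (2 * m + 3))) θ =
      angular m θ := by
  have : deriv (h (2 * m + 3)) =ᶠ[𝓝 θ] slope m := by
    filter_upwards [isOpen_Ioo.mem_nhds hθ] with x hx using (hasDerivAt_h m hx).deriv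
  rw [this.deriv_eq, (hasDerivAt_slope m hθ).deriv]
  ring

lemma continuousOn_h_Ioo (m : ℕ) : ContinuousOn (h (2 * m + 3)) (Ioo 0 Real.pi) :=
  fun _ hθ => (hasDerivAt_h m hθ).continuousAt.continuousWithinAt

lemma contDiffOn_h (m : ℕ) : ContDiffOn ℝ 2 (h (2 * m + 3)) (Ioo 0 Real.pi) := by
  have e1 : EqOn (deriv (h (2 * m + 3))) (slope m) (Ioo 0 Real.pi) :=
    fun x hx => (hasDerivAt_h m hx).deriv
  have e2 : EqOn (deriv (slope m))
      (fun θ => angular m θ - ((2 * m + 3 : ℕ) : ℝ) ^ 2 * h (2 * m + 3) θ) (Ioo 0 Real.pi) :=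
    fun x hx => (hasDerivAt_slope m hx).deriv
  have h1 : ContDiffOn ℝ 1 (slope m) (Ioo 0 Real.pi) := by
    rw [show (1 : WithTop ℕ∞) = 0 + 1 by norm_num, contDiffOn_succ_iff_deriv_of_isOpen isOpen_Ioo]
    refine ⟨fun x hx => (hasDerivAt_slope m hx).differentiableAt.differentiableWithinAt,
      by simp, ?_⟩
    rw [contDiffOn_zero]
    exact ((continuousOn_angular m).sub (continuousOn_const.mul (continuousOn_h_Ioo m))).congr e2
  rw [show (2 : WithTop ℕ∞) = 1 + 1 by norm_num, contDiffOn_succ_iff_deriv_of_isOpen isOpen_Ioo]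
  exact ⟨fun x hx => (hasDerivAt_h m hx).differentiableAt.differentiableWithinAt, by simp,
    h1.congr e1⟩

/-! ### Boundary behaviour -/

/-- For `l < 0` the phase is continuous and negative at the real point, so the zero lies beyond `l`
for small `θ`. For `l > 0` the real point lies on the branch cut, and continuity is replaced by
`exp_sq_mul_cos_le`, which is violated for small `θ` if `logRadius θ ≥ l`. -/
lemma tendsto_logRadius_zero : Tendsto logRadius (𝓝[>] 0) (𝓝 0) := by
  have hIoo : ∀ᶠ θ in 𝓝[>] (0 : ℝ), θ ∈ Ioo 0 Real.pi := Ioo_mem_nhdsGT Real.pi_pos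
  rw [tendsto_order]
  constructor
  · intro l hl
    have hc : ContinuousAt (fun θ => (phase (logPoint l θ)).re) 0 := by
      have h1 := (hasStrictDerivAt_phase (mem_rootDomain_of_neg hl)).hasDerivAt.continuousAt
      have h2 : ContinuousAt (fun θ : ℝ => logPoint l θ) 0 := by
        unfold logPoint
        fun_prop
      exact Complex.continuous_re.continuousAt.comp
        (ContinuousAt.comp (f := fun θ : ℝ => logPoint l θ) h1 h2)
    have hlt := hc.eventually_lt_const (phase_re_neg_of_neg hl)
    filter_upwards [hIoo, nhdsWithin_le_nhds hlt] with θ hθ h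
    rw [← phase_curve_re hθ] at h
    exact (strictMono_phase_re hθ).lt_iff_lt.mp h
  · intro l hl
    have hc : Continuous fun θ : ℝ => Real.exp l ^ 2 * Real.cos (2 * θ) := by fun_prop
    have h1 : 1 < Real.exp l ^ 2 * Real.cos (2 * 0) := by
      have := Real.one_lt_exp_iff.mpr hl
      simp only [mul_zero, Real.cos_zero, mul_one]
      nlinarith
    have hlt := hc.continuousAt.eventually_const_lt h1
    filter_upwards [hIoo, nhdsWithin_le_nhds hlt] with θ hθ h
    by_contra! hle
    have h2 := exp_sq_mul_cos_le (curve_mem_rootDomain hθ) (phase_curve_re hθ)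
    rw [curve_re, curve_im] at h2
    have h3 : 0 < Real.cos (2 * θ) := by
      by_contra! hneg
      have := mul_nonpos_of_nonneg_of_nonpos (sq_nonneg (Real.exp l)) hneg
      linarith
    have h4 : Real.exp l ^ 2 ≤ Real.exp (logRadius θ) ^ 2 := by gcongr
    nlinarith

lemma tendsto_curve_zero : Tendsto curve (𝓝[>] 0) (𝓝 0) := by
  have h1 := (Complex.continuous_ofReal.tendsto 0).comp tendsto_logRadius_zero
  have h2 : Tendsto (fun θ : ℝ => (θ : ℂ) * Complex.I) (𝓝[>] 0) (𝓝 ((0 : ℝ) * Complex.I)) :=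
    ((Complex.continuous_ofReal.mul continuous_const).tendsto 0).mono_left nhdsWithin_le_nhds
  have h3 := h1.add h2
  rw [Complex.ofReal_zero, zero_mul, add_zero] at h3
  exact h3

lemma tendsto_root_curve_zero : Tendsto (fun θ => root (curve θ)) (𝓝[>] 0) (𝓝 0) := by
  -- The limit point is the branch point of the root; passing to the square `1 - e^{2ζ}`, which is
  -- entire, avoids it.
  have h1 : Tendsto (fun θ => ‖root (curve θ)‖ ^ 2) (𝓝[>] 0) (𝓝 0) := by
    have hc : Continuous fun ζ : ℂ => ‖1 - Complex.exp (2 * ζ)‖ := by fun_prop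
    have := (hc.tendsto 0).comp tendsto_curve_zero
    simpa [Function.comp_def, ← norm_pow, root_sq] using this
  rw [tendsto_zero_iff_norm_tendsto_zero]
  have h2 := (Real.continuous_sqrt.tendsto 0).comp h1
  simpa [Function.comp_def] using h2

lemma tendsto_twistedTail_curve_zero (m : ℕ) :
    Tendsto (fun θ => twistedTail m (curve θ)) (𝓝[>] 0) (𝓝 (-primitive m (-Complex.I))) := by
  have h1 : Tendsto (fun θ => root (curve θ) * Complex.exp (-curve θ)) (𝓝[>] 0) (𝓝 0) := by
    have hc : Continuous fun ζ : ℂ => Complex.exp (-ζ) := by fun_prop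
    simpa [Function.comp_def] using
      tendsto_root_curve_zero.mul ((hc.tendsto 0).comp tendsto_curve_zero)
  have h2 := ((hasDerivAt_primitive m 0).continuousAt.tendsto.comp h1).sub_const
    (primitive m (-Complex.I))
  have h3 : Continuous fun ζ : ℂ => Complex.exp ((2 * m + 3 : ℕ) * ζ.im * Complex.I) := by
    fun_prop
  have h4 := ((h3.tendsto 0).comp tendsto_curve_zero).mul h2
  have h5 : primitive m 0 = 0 := by simp [primitive]
  simpa [twistedTail, tail, Function.comp_def, h5] using h4

/-- The Beta integral `∫₀¹ y² (1 - y²)^m dy`. -/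
noncomputable def betaInt (m : ℕ) : ℝ := ∫ y in (0 : ℝ)..1, y ^ 2 * (1 - y ^ 2) ^ m

/-- Integration along the segment `s = -iy`, on which `s² (1 + s²)^m ds = i y² (1 - y²)^m dy`. The
value is purely imaginary, so the limit at `θ = 0` contributes nothing to `h` and everything to its
slope. -/
lemma primitive_neg_I (m : ℕ) : primitive m (-Complex.I) = Complex.I * betaInt m := by
  have hd : ∀ y : ℝ, HasDerivAt (fun y : ℝ => primitive m (-Complex.I * y))
      (Complex.I * ((y ^ 2 * (1 - y ^ 2) ^ m : ℝ) : ℂ)) y := fun y => by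
    have h1 := (hasDerivAt_primitive m (-Complex.I * y)).comp y
      ((Complex.ofRealCLM.hasDerivAt (x := y)).const_mul (-Complex.I))
    convert! h1 using 1
    have : (-Complex.I * y) ^ 2 = -(y : ℂ) ^ 2 := by
      rw [mul_pow, neg_sq, Complex.I_sq]; ring
    rw [this]
    push_cast
    simp
    ring
  have := intervalIntegral.integral_eq_sub_of_hasDerivAt (a := 0) (b := 1) (fun y _ => hd y)
    (Continuous.intervalIntegrable (by fun_prop) _ _)
  have h5 : primitive m 0 = 0 := by simp [primitive]
  rw [intervalIntegral.integral_const_mul, intervalIntegral.integral_ofReal] at this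
  simp only [Complex.ofReal_one, mul_one, Complex.ofReal_zero, mul_zero, h5, sub_zero] at this
  rw [← this, betaInt]

lemma betaInt_zero : betaInt 0 = 1 / 3 := by
  simp [betaInt]
  norm_num

/-- `y³ (1 - y²)^{m+1}` vanishes at both ends, and `y⁴ = y² - y² (1 - y²)` rewrites its derivative
in the two integrands. The recursion matches the functional equation of `Γ` in `betaInt_eq`. -/
lemma betaInt_succ (m : ℕ) : (2 * m + 5) * betaInt (m + 1) = 2 * (m + 1) * betaInt m := by
  have hd : ∀ y : ℝ, HasDerivAt (fun y : ℝ => y ^ 3 * (1 - y ^ 2) ^ (m + 1))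
      ((2 * m + 5) * (y ^ 2 * (1 - y ^ 2) ^ (m + 1)) -
        2 * (m + 1) * (y ^ 2 * (1 - y ^ 2) ^ m)) y := fun y => by
    have h1 := (hasDerivAt_pow 3 y).mul (((hasDerivAt_pow 2 y).const_sub 1).pow (m + 1))
    convert! h1 using 1
    simp
    ring
  have := intervalIntegral.integral_eq_sub_of_hasDerivAt (a := 0) (b := 1) (fun y _ => hd y)
    (Continuous.intervalIntegrable (by fun_prop) _ _)
  rw [intervalIntegral.integral_sub (Continuous.intervalIntegrable (by fun_prop) _ _)
    (Continuous.intervalIntegrable (by fun_prop) _ _), intervalIntegral.integral_const_mul,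
    intervalIntegral.integral_const_mul] at this
  simp at this
  unfold betaInt
  linarith

lemma betaInt_eq (m : ℕ) :
    4 * betaInt m * Real.Gamma (m + 5 / 2) = Real.sqrt Real.pi * Real.Gamma (m + 1) := by
  induction m with
  | zero =>
    rw [betaInt_zero]
    have h1 : Real.Gamma (1 / 2 + 1) = 1 / 2 * Real.Gamma (1 / 2) := Real.Gamma_add_one (by norm_num)
    have h2 : Real.Gamma (3 / 2 + 1) = 3 / 2 * Real.Gamma (3 / 2) := Real.Gamma_add_one (by norm_num)
    norm_num at h1 h2 ⊢
    rw [h2, h1, Real.Gamma_one_half_eq]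
    ring
  | succ m ih =>
    have h1 : Real.Gamma (m + 5 / 2 + 1) = (m + 5 / 2) * Real.Gamma (m + 5 / 2) :=
      Real.Gamma_add_one (by positivity)
    have h2 : Real.Gamma (m + 1 + 1) = (m + 1) * Real.Gamma (m + 1) :=
      Real.Gamma_add_one (by positivity)
    have e : ((m + 1 : ℕ) : ℝ) + 5 / 2 = m + 5 / 2 + 1 := by push_cast; ring
    rw [e, h1, Nat.cast_add, Nat.cast_one, h2]
    linear_combination 2 * Real.Gamma (m + 5 / 2) * betaInt_succ m + (m + 1) * ih

lemma scale_mul_betaInt (m : ℕ) : scale m * betaInt m = e (2 * m + 3) := by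
  have h1 : (((2 * m + 3 : ℕ) : ℝ) - 1) / 2 = m + 1 := by push_cast; ring
  have h2 : 1 + ((2 * m + 3 : ℕ) : ℝ) / 2 = m + 5 / 2 := by push_cast; ring
  have h3 : 0 < Real.Gamma ((m : ℝ) + 5 / 2) := Real.Gamma_pos_of_pos (by positivity)
  rw [e, scale, h1, h2, ← betaInt_eq]
  field_simp

lemma tendsto_h_zero (m : ℕ) : Tendsto (h (2 * m + 3)) (𝓝[>] 0) (𝓝 0) := by
  have h1 := ((Complex.continuous_re.tendsto _).comp
    (tendsto_twistedTail_curve_zero m)).const_mul (scale m / (2 * m + 3 : ℕ))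
  rw [primitive_neg_I] at h1
  simp only [Complex.neg_re, Complex.I_mul_re, Complex.ofReal_im, neg_zero, mul_zero] at h1
  refine h1.congr' ?_
  filter_upwards [Ioo_mem_nhdsGT Real.pi_pos] with θ hθ using (h_eq m hθ).symm

lemma tendsto_slope_zero (m : ℕ) : Tendsto (slope m) (𝓝[>] 0) (𝓝 (e (2 * m + 3))) := by
  have h1 := (((Complex.continuous_im.tendsto _).comp
    (tendsto_twistedTail_curve_zero m)).const_mul (scale m)).neg
  rw [primitive_neg_I] at h1
  rw [Complex.neg_im, Complex.I_mul_im, Complex.ofReal_re, mul_neg, neg_neg,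
    scale_mul_betaInt] at h1
  exact h1

/-- Numerator and denominator of `|w|² / Re w` both vanish at the end; the sector bound `|Im w| ≤ Re
w` controls the quotient by `2 Re w`. -/
lemma tendsto_angular_zero (m : ℕ) : Tendsto (angular m) (𝓝[>] 0) (𝓝 0) := by
  have h1 : Tendsto (fun θ => Complex.normSq (root (curve θ)) / (root (curve θ)).re) (𝓝[>] 0)
      (𝓝 0) := by
    have hb : Tendsto (fun θ => 2 * (root (curve θ)).re) (𝓝[>] 0) (𝓝 0) := by
      simpa [Function.comp_def] using
        ((Complex.continuous_re.tendsto 0).comp tendsto_root_curve_zero).const_mul 2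
    have hIoo : ∀ᶠ θ in 𝓝[>] (0 : ℝ), θ ∈ Ioo 0 Real.pi := Ioo_mem_nhdsGT Real.pi_pos
    refine squeeze_zero' ?_ ?_ hb
    · filter_upwards [hIoo] with θ hθ
      exact div_nonneg (Complex.normSq_nonneg _) (root_re_pos (curve_mem_rootDomain hθ)).le
    · filter_upwards [hIoo] with θ hθ
      rw [div_le_iff₀ (root_re_pos (curve_mem_rootDomain hθ)), Complex.normSq_apply]
      have := root_im_sq_le (curve_mem_rootDomain hθ) (phase_curve_re hθ)
      nlinarith
  have h2 : Continuous fun l : ℝ => Real.exp (-((2 * m + 3 : ℕ) * l)) := by fun_prop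
  have h3 := (h1.mul ((h2.tendsto 0).comp tendsto_logRadius_zero)).const_mul (scale m)
  rw [zero_mul, mul_zero] at h3
  exact h3

/-! ### Reflection in the imaginary axis -/

lemma pi_sub_mem_Ioo {θ : ℝ} : Real.pi - θ ∈ Ioo 0 Real.pi ↔ θ ∈ Ioo 0 Real.pi := by
  constructor <;> rintro ⟨h1, h2⟩ <;> constructor <;> linarith

/-- The reflection `z ↦ -conj z` is `ζ ↦ conj ζ + iπ`, which conjugates `e^{2ζ}`; off the cut the
principal root commutes with conjugation. -/
lemma root_pi_sub {θ : ℝ} (hθ : θ ∈ Ioo 0 Real.pi) (l : ℝ) :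
    root (logPoint l (Real.pi - θ)) = starRingEnd ℂ (root (logPoint l θ)) := by
  have hm := logPoint_mem_rootDomain hθ l
  have h1 : Complex.exp (2 * logPoint l (Real.pi - θ)) =
      starRingEnd ℂ (Complex.exp (2 * logPoint l θ)) := by
    rw [← Complex.exp_conj]
    have : 2 * logPoint l (Real.pi - θ) =
        starRingEnd ℂ (2 * logPoint l θ) + 2 * Real.pi * Complex.I := by
      rw [map_mul, Complex.conj_ofNat]
      simp [logPoint]
      ring
    rw [this, Complex.exp_periodic]
  have h2 : 1 - starRingEnd ℂ (Complex.exp (2 * logPoint l θ)) =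
      starRingEnd ℂ (1 - Complex.exp (2 * logPoint l θ)) := by simp
  rw [root, root, h1, h2, Complex.conj_cpow _ _ (Complex.slitPlane_arg_ne_pi hm), one_div, map_inv₀,
    Complex.conj_ofNat]

lemma phase_re_pi_sub {θ : ℝ} (hθ : θ ∈ Ioo 0 Real.pi) (l : ℝ) :
    (phase (logPoint l (Real.pi - θ))).re = (phase (logPoint l θ)).re := by
  rw [phase_re, phase_re, root_pi_sub hθ, logPoint_re, logPoint_re, Complex.conj_re]
  have : (1 : ℂ) + starRingEnd ℂ (root (logPoint l θ)) =
      starRingEnd ℂ (1 + root (logPoint l θ)) := by simp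
  rw [this, Complex.norm_conj]

lemma logRadius_pi_sub {θ : ℝ} (hθ : θ ∈ Ioo 0 Real.pi) :
    logRadius (Real.pi - θ) = logRadius θ := by
  symm
  apply eq_logRadius (pi_sub_mem_Ioo.mpr hθ)
  rw [phase_re_pi_sub hθ]
  exact phase_curve_re hθ

lemma h_pi_sub (d : ℕ) (θ : ℝ) : h d (Real.pi - θ) = h d θ := by
  by_cases hθ : θ ∈ Ioo 0 Real.pi
  · rw [h, h, if_pos (mem_Ioo.mp hθ), if_pos (mem_Ioo.mp (pi_sub_mem_Ioo.mpr hθ))]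
    congr 1
    refine setIntegral_congr_fun measurableSet_Ioi fun t ht => ?_
    rw [hIntegrand_eq d hθ ht, hIntegrand_eq d (pi_sub_mem_Ioo.mpr hθ) ht, phase_re_pi_sub hθ]
  · rw [h_eq_zero d hθ, h_eq_zero d (mt pi_sub_mem_Ioo.mp hθ)]

lemma slope_pi_sub (m : ℕ) {θ : ℝ} (hθ : θ ∈ Ioo 0 Real.pi) :
    slope m (Real.pi - θ) = -slope m θ := by
  have h1 := (hasDerivAt_h m (pi_sub_mem_Ioo.mpr hθ)).comp θ ((hasDerivAt_id θ).const_sub Real.pi)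
  have h2 : h (2 * m + 3) ∘ HSub.hSub Real.pi = h (2 * m + 3) := by
    ext x
    exact h_pi_sub _ x
  rw [h2] at h1
  linarith [h1.unique (hasDerivAt_h m hθ)]

lemma angular_pi_sub (m : ℕ) {θ : ℝ} (hθ : θ ∈ Ioo 0 Real.pi) :
    angular m (Real.pi - θ) = angular m θ := by
  rw [angular, angular, curve, logRadius_pi_sub hθ, root_pi_sub hθ, Complex.normSq_conj,
    Complex.conj_re]
  rfl

lemma tendsto_pi_sub_nhdsLT : Tendsto (fun θ => Real.pi - θ) (𝓝[<] Real.pi) (𝓝[>] 0) := by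
  apply tendsto_nhdsWithin_of_tendsto_nhds_of_eventually_within
  · have : Continuous fun θ : ℝ => Real.pi - θ := by fun_prop
    simpa using (this.tendsto Real.pi).mono_left nhdsWithin_le_nhds
  · filter_upwards [self_mem_nhdsWithin] with θ hθ
    exact sub_pos.mpr (mem_Iio.mp hθ)

lemma tendsto_slope_pi (m : ℕ) : Tendsto (slope m) (𝓝[<] Real.pi) (𝓝 (-e (2 * m + 3))) := by
  refine ((tendsto_slope_zero m).comp tendsto_pi_sub_nhdsLT).neg.congr' ?_
  filter_upwards [Ioo_mem_nhdsLT Real.pi_pos] with θ hθ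
  simp [slope_pi_sub m hθ]

/-- A function on the line that vanishes off `(0, π)`, is continuous inside, symmetric about `π / 2`
and tends to zero at the left end is continuous. -/
lemma continuous_of_symmetric {f : ℝ → ℝ} (hf : ∀ θ ∉ Ioo 0 Real.pi, f θ = 0)
    (hc : ContinuousOn f (Ioo 0 Real.pi)) (hs : ∀ θ, f (Real.pi - θ) = f θ)
    (h0 : Tendsto f (𝓝[>] 0) (𝓝 0)) : Continuous f := by
  have hzero : ContinuousAt f 0 := by
    have hf0 : f 0 = 0 := hf 0 (by simp)
    rw [continuousAt_iff_continuous_left'_right', ContinuousWithinAt, ContinuousWithinAt, hf0]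
    refine ⟨tendsto_const_nhds.congr' ?_, h0⟩
    filter_upwards [self_mem_nhdsWithin] with θ hθ
    exact (hf θ fun h => lt_asymm h.1 hθ).symm
  rw [continuous_iff_continuousAt]
  intro θ
  by_cases hθ : θ ∈ Ioo 0 Real.pi
  · exact hc.continuousAt (isOpen_Ioo.mem_nhds hθ)
  rcases lt_trichotomy θ 0 with h | h | h
  · refine continuousAt_const (y := (0 : ℝ)) |>.congr ?_
    filter_upwards [Iio_mem_nhds h] with x hx
    exact (hf x fun h => lt_asymm h.1 hx).symm
  · exact h ▸ hzero
  rcases (not_lt.mp fun h' => hθ ⟨h, h'⟩ : Real.pi ≤ θ).eq_or_lt with h' | h'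
  · have hsub : f = f ∘ fun θ => Real.pi - θ := funext fun θ => (hs θ).symm
    rw [hsub, ← h']
    refine ContinuousAt.comp ?_ (by fun_prop)
    simpa using hzero
  · refine continuousAt_const (y := (0 : ℝ)) |>.congr ?_
    filter_upwards [Ioi_mem_nhds h'] with x hx
    exact (hf x fun h => lt_asymm h.2 hx).symm

lemma continuous_h (m : ℕ) : Continuous (h (2 * m + 3)) :=
  continuous_of_symmetric (fun _ => h_eq_zero _) (continuousOn_h_Ioo m) (h_pi_sub _)
    (tendsto_h_zero m)

/-- The function `d² h + h''` on `(0, π)`, extended by zero. -/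
noncomputable def angularExt (m : ℕ) : ℝ → ℝ := (Ioo 0 Real.pi).indicator (angular m)

lemma angularExt_of_mem (m : ℕ) {θ : ℝ} (hθ : θ ∈ Ioo 0 Real.pi) :
    angularExt m θ = angular m θ := indicator_of_mem hθ _

/-- Zero limits at both ends make the extension continuous. This yields a continuous density on the
whole plane and integrability up to the axis in Green's identity. -/
lemma continuous_angularExt (m : ℕ) : Continuous (angularExt m) := by
  refine continuous_of_symmetric (fun _ hθ => indicator_of_notMem hθ _)
    ((continuousOn_angular m).congr fun _ hθ => indicator_of_mem hθ _) (fun θ => ?_) ?_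
  · by_cases hθ : θ ∈ Ioo 0 Real.pi
    · rw [angularExt_of_mem m hθ, angularExt_of_mem m (pi_sub_mem_Ioo.mpr hθ), angular_pi_sub m hθ]
    · rw [angularExt, indicator_of_notMem hθ, indicator_of_notMem (mt pi_sub_mem_Ioo.mp hθ)]
  · refine (tendsto_angular_zero m).congr' ?_
    filter_upwards [Ioo_mem_nhdsGT Real.pi_pos] with θ hθ using (angularExt_of_mem m hθ).symm

lemma angularExt_nonneg (m : ℕ) (θ : ℝ) : 0 ≤ angularExt m θ :=
  indicator_nonneg (fun _ hθ => angular_nonneg m hθ) θ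

lemma c_pos (m : ℕ) : 0 < c (2 * m + 3) := by
  have : 0 < ∫ θ in (0 : ℝ)..Real.pi, h (2 * m + 3) θ :=
    intervalIntegral.intervalIntegral_pos_of_pos_on ((continuous_h m).intervalIntegrable _ _)
      (fun θ hθ => h_pos m hθ) Real.pi_pos
  unfold c
  have := Real.pi_pos
  positivity

lemma e_nonneg (m : ℕ) : 0 ≤ e (2 * m + 3) := by
  rw [← scale_mul_betaInt]
  refine mul_nonneg (scale_pos m).le (intervalIntegral.integral_nonneg zero_le_one fun y hy => ?_)
  have : 0 ≤ 1 - y ^ 2 := by nlinarith [hy.1, hy.2]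
  positivity

/-! ### The Laplacian in polar coordinates -/

/-- The point with polar coordinates `(r, θ)`. -/
noncomputable def polar (r θ : ℝ) : ℂ := r * Complex.exp (θ * Complex.I)

/-- The second derivative `(r ∂_r)² φ`. -/
noncomputable def radialPart (φ : ℂ → ℝ) (z : ℂ) : ℝ :=
  fderiv ℝ (fderiv ℝ φ) z z z + fderiv ℝ φ z z

/-- The second derivative `∂_θ² φ`. -/
noncomputable def angularPart (φ : ℂ → ℝ) (z : ℂ) : ℝ :=
  fderiv ℝ (fderiv ℝ φ) z (Complex.I * z) (Complex.I * z) - fderiv ℝ φ z z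

lemma laplacian_eq_fderiv (φ : ℂ → ℝ) (z : ℂ) :
    (Δ φ) z = fderiv ℝ (fderiv ℝ φ) z 1 1 + fderiv ℝ (fderiv ℝ φ) z Complex.I Complex.I := by
  rw [InnerProductSpace.laplacian_eq_iteratedFDeriv_complexPlane]
  simp [iteratedFDeriv_two_apply]

/-- Expanding in the basis `1, I`, the mixed second derivatives cancel in pairs and the first-order
terms are opposite. -/
lemma radialPart_add_angularPart (φ : ℂ → ℝ) (z : ℂ) :
    radialPart φ z + angularPart φ z = ‖z‖ ^ 2 * (Δ φ) z := by
  rw [laplacian_eq_fderiv, radialPart, angularPart]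
  set B := fderiv ℝ (fderiv ℝ φ) z
  have h1 : B z = z.re • B 1 + z.im • B Complex.I := by
    rw [← map_smul, ← map_smul, ← map_add]
    congr 1
    simp [Complex.re_add_im]
  have hI : Complex.I * z = z.re • Complex.I - z.im • (1 : ℂ) := by
    apply Complex.ext <;> simp
  have h2 : B (Complex.I * z) = z.re • B Complex.I - z.im • B 1 := by
    rw [hI, map_sub, map_smul, map_smul]
  have h3 : ∀ l : ℂ →L[ℝ] ℝ, l z = z.re * l 1 + z.im * l Complex.I := fun l => by
    rw [← smul_eq_mul, ← smul_eq_mul, ← map_smul, ← map_smul, ← map_add]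
    congr 1
    simp [Complex.re_add_im]
  have h4 : ∀ l : ℂ →L[ℝ] ℝ, l (Complex.I * z) = z.re * l Complex.I - z.im * l 1 := fun l => by
    rw [hI, map_sub, map_smul, map_smul]
    rfl
  rw [← Complex.normSq_eq_norm_sq, Complex.normSq_apply, h1, h2]
  simp only [add_apply, sub_apply,
    smul_apply, smul_eq_mul, h3, h4]
  ring

lemma continuous_polar : Continuous fun p : ℝ × ℝ => polar p.1 p.2 := by
  unfold polar
  fun_prop

lemma norm_polar {r : ℝ} (hr : 0 ≤ r) (θ : ℝ) : ‖polar r θ‖ = r := by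
  rw [polar, norm_mul, Complex.norm_exp_ofReal_mul_I, mul_one, Complex.norm_real,
    Real.norm_of_nonneg hr]

@[simp] lemma polar_zero_left (θ : ℝ) : polar 0 θ = 0 := by simp [polar]

@[simp] lemma polar_zero_right (r : ℝ) : polar r 0 = r := by simp [polar]

@[simp] lemma polar_pi (r : ℝ) : polar r Real.pi = (-r : ℝ) := by simp [polar]

lemma polar_two_pi (r : ℝ) : polar r (2 * Real.pi) = r := by simp [polar]

lemma hasDerivAt_polar_radius (r θ : ℝ) :
    HasDerivAt (fun r => polar r θ) (Complex.exp (θ * Complex.I)) r := by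
  simpa [polar] using (Complex.ofRealCLM.hasDerivAt (x := r)).mul_const
    (Complex.exp (θ * Complex.I))

lemma hasDerivAt_polar_angle (r θ : ℝ) :
    HasDerivAt (fun θ => polar r θ) (Complex.I * polar r θ) θ := by
  have h1 := (((Complex.ofRealCLM.hasDerivAt (x := θ)).mul_const Complex.I).cexp).const_mul (r : ℂ)
  convert! h1 using 1
  simp [polar]
  ring

section Derivatives

variable {φ : ℂ → ℝ}

lemma hasDerivAt_radius (hφ : ContDiff ℝ 2 φ) (r θ : ℝ) :
    HasDerivAt (fun r => φ (polar r θ))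
      (fderiv ℝ φ (polar r θ) (Complex.exp (θ * Complex.I))) r :=
  (hφ.differentiable (by norm_num) _).hasFDerivAt.comp_hasDerivAt r (hasDerivAt_polar_radius r θ)

lemma hasDerivAt_angle (hφ : ContDiff ℝ 2 φ) (r θ : ℝ) :
    HasDerivAt (fun θ => φ (polar r θ)) (fderiv ℝ φ (polar r θ) (Complex.I * polar r θ)) θ :=
  (hφ.differentiable (by norm_num) _).hasFDerivAt.comp_hasDerivAt θ (hasDerivAt_polar_angle r θ)

lemma contDiff_fderiv_one (hφ : ContDiff ℝ 2 φ) : ContDiff ℝ 1 (fderiv ℝ φ) :=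
  hφ.fderiv_right (by norm_num)

lemma hasDerivAt_fderiv_radius (hφ : ContDiff ℝ 2 φ) (r θ : ℝ) :
    HasDerivAt (fun r => fderiv ℝ φ (polar r θ) (polar r θ))
      (fderiv ℝ (fderiv ℝ φ) (polar r θ) (Complex.exp (θ * Complex.I)) (polar r θ) +
        fderiv ℝ φ (polar r θ) (Complex.exp (θ * Complex.I))) r :=
  (((contDiff_fderiv_one hφ).differentiable (by norm_num) _).hasFDerivAt.comp_hasDerivAt r
    (hasDerivAt_polar_radius r θ)).clm_apply (hasDerivAt_polar_radius r θ)

lemma hasDerivAt_fderiv_angle (hφ : ContDiff ℝ 2 φ) (r θ : ℝ) :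
    HasDerivAt (fun θ => fderiv ℝ φ (polar r θ) (Complex.I * polar r θ))
      (angularPart φ (polar r θ)) θ := by
  have h := (((contDiff_fderiv_one hφ).differentiable (by norm_num) _).hasFDerivAt.comp_hasDerivAt θ
    (hasDerivAt_polar_angle r θ)).clm_apply ((hasDerivAt_polar_angle r θ).const_mul Complex.I)
  convert! h using 1
  rw [angularPart, ← mul_assoc, Complex.I_mul_I, neg_one_mul, map_neg]
  rfl

lemma mul_radial_eq (φ : ℂ → ℝ) (r θ : ℝ) :
    r * (fderiv ℝ (fderiv ℝ φ) (polar r θ) (Complex.exp (θ * Complex.I)) (polar r θ) +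
        fderiv ℝ φ (polar r θ) (Complex.exp (θ * Complex.I))) = radialPart φ (polar r θ) := by
  have h1 : polar r θ = r • Complex.exp (θ * Complex.I) := by simp [polar]
  rw [radialPart]
  generalize fderiv ℝ (fderiv ℝ φ) (polar r θ) = B
  generalize fderiv ℝ φ (polar r θ) = l
  rw [h1]
  simp only [map_smul, smul_apply, smul_eq_mul]
  ring

lemma continuous_fderiv_fderiv (hφ : ContDiff ℝ 2 φ) : Continuous (fderiv ℝ (fderiv ℝ φ)) :=
  (contDiff_fderiv_one hφ).continuous_fderiv (by norm_num)

lemma continuous_radialPart (hφ : ContDiff ℝ 2 φ) : Continuous (radialPart φ) := by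
  have h1 := continuous_fderiv_fderiv hφ
  have h2 := (contDiff_fderiv_one hφ).continuous
  unfold radialPart
  exact ((h1.clm_apply continuous_id).clm_apply continuous_id).add (h2.clm_apply continuous_id)

lemma continuous_angularPart (hφ : ContDiff ℝ 2 φ) : Continuous (angularPart φ) := by
  have h1 := continuous_fderiv_fderiv hφ
  have h2 := (contDiff_fderiv_one hφ).continuous
  have h3 : Continuous fun z : ℂ => Complex.I * z := continuous_const.mul continuous_id
  unfold angularPart
  exact ((h1.clm_apply h3).clm_apply h3).sub (h2.clm_apply continuous_id)

lemma continuous_laplacian (hφ : ContDiff ℝ 2 φ) : Continuous (Δ φ) := by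
  have h1 := continuous_fderiv_fderiv hφ
  rw [funext (laplacian_eq_fderiv φ)]
  exact ((h1.clm_apply continuous_const).clm_apply continuous_const).add
    ((h1.clm_apply continuous_const).clm_apply continuous_const)

/-! ### The submean inequality for smooth functions -/

/-- The angular part is a `θ`-derivative of a periodic function and integrates to zero over the
circle, so the radial part carries the whole integral of `r² Δφ`. -/
lemma integral_laplacian_circle_nonneg (hφ : ContDiff ℝ 2 φ) (hΔ : ∀ z, 0 ≤ (Δ φ) z) (r : ℝ) :
    0 ≤ ∫ θ in (0 : ℝ)..2 * Real.pi, radialPart φ (polar r θ) := by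
  have hc : Continuous fun θ : ℝ => polar r θ :=
    continuous_polar.comp (Continuous.prodMk_right r)
  have h1 : ∫ θ in (0 : ℝ)..2 * Real.pi, angularPart φ (polar r θ) = 0 := by
    rw [intervalIntegral.integral_eq_sub_of_hasDerivAt
      (fun θ _ => hasDerivAt_fderiv_angle hφ r θ)
      (((continuous_angularPart hφ).comp hc).intervalIntegrable _ _), polar_two_pi,
      polar_zero_right, sub_self]
  have h2 : ∫ θ in (0 : ℝ)..2 * Real.pi, radialPart φ (polar r θ) =
      ∫ θ in (0 : ℝ)..2 * Real.pi, (radialPart φ (polar r θ) + angularPart φ (polar r θ)) := by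
    have c1 : Continuous fun θ => radialPart φ (polar r θ) := (continuous_radialPart hφ).comp hc
    have c2 : Continuous fun θ => angularPart φ (polar r θ) := (continuous_angularPart hφ).comp hc
    rw [intervalIntegral.integral_add (c1.intervalIntegrable _ _) (c2.intervalIntegrable _ _), h1,
      add_zero]
  rw [h2]
  refine intervalIntegral.integral_nonneg Real.two_pi_pos.le fun θ _ => ?_
  rw [radialPart_add_angularPart]
  exact mul_nonneg (sq_nonneg _) (hΔ _)

lemma intervalIntegral_swap_of_continuous {f : ℝ → ℝ → ℝ}
    (hf : Continuous fun p : ℝ × ℝ => f p.1 p.2) (a b c d : ℝ) :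
    ∫ x in a..b, ∫ y in c..d, f x y = ∫ y in c..d, ∫ x in a..b, f x y := by
  apply intervalIntegral_intervalIntegral_swap
  have : IntegrableOn (Function.uncurry f) (uIcc a b ×ˢ uIcc c d) :=
    hf.continuousOn.integrableOn_compact (isCompact_uIcc.prod isCompact_uIcc)
  exact this.mono_set (prod_mono uIoc_subset_uIcc uIoc_subset_uIcc)

/-- If `M(r)` is the circle mean, then `(r ∂_r)² M ≥ 0`, so `r M'` increases from `0`. One more
radial integration, in the next lemma, gives `M(0) ≤ M(r)`. -/
lemma integral_radial_nonneg_of_laplacian_nonneg (hφ : ContDiff ℝ 2 φ) (hΔ : ∀ z, 0 ≤ (Δ φ) z)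
    {r : ℝ} (hr : 0 ≤ r) :
    0 ≤ ∫ θ in (0 : ℝ)..2 * Real.pi, fderiv ℝ φ (polar r θ) (polar r θ) := by
  set Y : ℝ → ℝ → ℝ := fun r θ =>
    fderiv ℝ (fderiv ℝ φ) (polar r θ) (Complex.exp (θ * Complex.I)) (polar r θ) +
        fderiv ℝ φ (polar r θ) (Complex.exp (θ * Complex.I)) with hY
  have he : Continuous fun p : ℝ × ℝ => Complex.exp (p.2 * Complex.I) := by fun_prop
  have hYc : Continuous fun p : ℝ × ℝ => Y p.1 p.2 :=
    ((((continuous_fderiv_fderiv hφ).comp continuous_polar).clm_apply he).clm_apply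
      continuous_polar).add
      (((contDiff_fderiv_one hφ).continuous.comp continuous_polar).clm_apply he)
  have h1 : ∀ θ, fderiv ℝ φ (polar r θ) (polar r θ) = ∫ t in (0 : ℝ)..r, Y t θ := fun θ => by
    rw [intervalIntegral.integral_eq_sub_of_hasDerivAt
      (fun t _ => hasDerivAt_fderiv_radius hφ t θ)
      ((hYc.comp (Continuous.prodMk_left θ)).intervalIntegrable _ _)]
    simp
  simp_rw [h1]
  rw [intervalIntegral_swap_of_continuous (f := fun θ t => Y t θ) (hYc.comp continuous_swap)]
  refine intervalIntegral.integral_nonneg_of_ae_restrict hr ?_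
  -- The null set `t = 0` is discarded because a factor `t` has to be divided out.
  filter_upwards [(ae_restrict_iff' measurableSet_Icc).mpr (ae_of_all volume fun t ht => ht),
    (measure_eq_zero_iff_ae_notMem.mp
      (show volume.restrict (Icc 0 r) {(0 : ℝ)} = 0 by
        exact measure_mono_null (le_refl _) (by simp)))] with t ht ht0
  have htpos : 0 < t := lt_of_le_of_ne ht.1 (fun h => ht0 (by simp [h]))
  have h2 := integral_laplacian_circle_nonneg hφ hΔ t
  simp_rw [← mul_radial_eq] at h2
  rw [intervalIntegral.integral_const_mul] at h2
  exact nonneg_of_mul_nonneg_right h2 htpos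

lemma le_circleAverage_of_laplacian_nonneg (hφ : ContDiff ℝ 2 φ) (hΔ : ∀ z, 0 ≤ (Δ φ) z)
    {r : ℝ} (hr : 0 < r) : φ 0 ≤ Real.circleAverage φ 0 r := by
  have he : Continuous fun p : ℝ × ℝ => Complex.exp (p.2 * Complex.I) := by fun_prop
  have hYc : Continuous fun p : ℝ × ℝ =>
      fderiv ℝ φ (polar p.1 p.2) (Complex.exp (p.2 * Complex.I)) :=
    ((contDiff_fderiv_one hφ).continuous.comp continuous_polar).clm_apply he
  have h1 : ∀ θ, φ (polar r θ) = φ 0 +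
      ∫ t in (0 : ℝ)..r, fderiv ℝ φ (polar t θ) (Complex.exp (θ * Complex.I)) := fun θ => by
    rw [intervalIntegral.integral_eq_sub_of_hasDerivAt
      (fun t _ => hasDerivAt_radius hφ t θ)
      ((hYc.comp (Continuous.prodMk_left θ)).intervalIntegrable _ _)]
    simp
  have hswap := intervalIntegral_swap_of_continuous
    (f := fun θ t => fderiv ℝ φ (polar t θ) (Complex.exp (θ * Complex.I)))
    (hYc.comp continuous_swap) 0 (2 * Real.pi) 0 r
  have h2 : 0 ≤ ∫ θ in (0 : ℝ)..2 * Real.pi,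
      ∫ t in (0 : ℝ)..r, fderiv ℝ φ (polar t θ) (Complex.exp (θ * Complex.I)) := by
    rw [hswap]
    refine intervalIntegral.integral_nonneg_of_ae_restrict hr.le ?_
    filter_upwards [(ae_restrict_iff' measurableSet_Icc).mpr (ae_of_all volume fun t ht => ht),
      (measure_eq_zero_iff_ae_notMem.mp
        (show volume.restrict (Icc 0 r) {(0 : ℝ)} = 0 by
          exact measure_mono_null (le_refl _) (by simp)))] with t ht ht0
    have htpos : 0 < t := lt_of_le_of_ne ht.1 (fun h => ht0 (by simp [h]))
    have h3 := integral_radial_nonneg_of_laplacian_nonneg hφ hΔ ht.1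
    have h4 : ∀ θ, fderiv ℝ φ (polar t θ) (polar t θ) =
        t * fderiv ℝ φ (polar t θ) (Complex.exp (θ * Complex.I)) := fun θ => by
      rw [← smul_eq_mul, ← map_smul]
      simp [polar]
    simp_rw [h4] at h3
    rw [intervalIntegral.integral_const_mul] at h3
    exact nonneg_of_mul_nonneg_right h3 htpos
  have h5 : Real.circleAverage φ 0 r = (2 * Real.pi)⁻¹ *
      ∫ θ in (0 : ℝ)..2 * Real.pi, φ (polar r θ) := by
    simp [Real.circleAverage, polar, circleMap]
  have h6 : Continuous fun θ => ∫ t in (0 : ℝ)..r,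
      fderiv ℝ φ (polar t θ) (Complex.exp (θ * Complex.I)) :=
    intervalIntegral.continuous_parametric_intervalIntegral_of_continuous'
      (f := fun θ t => fderiv ℝ φ (polar t θ) (Complex.exp (θ * Complex.I)))
      (hYc.comp continuous_swap) 0 r
  simp_rw [h5, h1]
  rw [intervalIntegral.integral_add (by simp) (h6.intervalIntegrable _ _),
    intervalIntegral.integral_const, sub_zero, smul_eq_mul, mul_add, ← mul_assoc,
    inv_mul_cancel₀ Real.two_pi_pos.ne', one_mul]
  have := Real.two_pi_pos
  have : 0 ≤ (2 * Real.pi)⁻¹ * ∫ θ in (0 : ℝ)..2 * Real.pi,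
      ∫ t in (0 : ℝ)..r, fderiv ℝ φ (polar t θ) (Complex.exp (θ * Complex.I)) := by positivity
  linarith

end Derivatives

/-! ### Subharmonicity from a positive distributional Laplacian -/

lemma contDiff_two_of_infty {f : ℂ → ℝ} (hf : ContDiff ℝ ∞ f) : ContDiff ℝ 2 f := by
  exact_mod_cast contDiff_infty.mp hf 2

/-- The Laplacian may be computed in any orthonormal basis, in particular in the image of the
standard one under `L`. -/
lemma laplacian_comp_linearIsometryEquiv {f : ℂ → ℝ} (hf : ContDiff ℝ 2 f) (L : ℂ ≃ₗᵢ[ℝ] ℂ)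
    (z : ℂ) : (Δ (fun x => f (L x))) z = (Δ f) (L z) := by
  rw [InnerProductSpace.laplacian_eq_iteratedFDeriv_complexPlane,
    InnerProductSpace.laplacian_eq_iteratedFDeriv_orthonormalBasis f
      (Complex.orthonormalBasisOneI.map L)]
  have h := ContinuousLinearMap.iteratedFDeriv_comp_right
    (L : ℂ →L[ℝ] ℂ) hf z (i := 2) le_rfl
  change iteratedFDeriv ℝ 2 (fun x => f (L x)) z = _ at h
  beta_reduce
  rw [h]
  simp only [ContinuousMultilinearMap.compContinuousLinearMap_apply, Fin.sum_univ_two,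
    OrthonormalBasis.map_apply, Complex.coe_orthonormalBasisOneI]
  congr 2 <;> ext i <;> fin_cases i <;> rfl

lemma laplacian_comp_add_left (f : ℂ → ℝ) (a z : ℂ) :
    (Δ (fun x => f (a + x))) z = (Δ f) (a + z) := by
  rw [InnerProductSpace.laplacian_eq_iteratedFDeriv_complexPlane,
    InnerProductSpace.laplacian_eq_iteratedFDeriv_complexPlane]
  simp only [iteratedFDeriv_comp_add_left]

lemma laplacian_comp_sub {f : ℂ → ℝ} (hf : ContDiff ℝ 2 f) (a z : ℂ) :
    (Δ (fun x => f (a - x))) z = (Δ f) (a - z) := by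
  have h1 := laplacian_comp_linearIsometryEquiv (f := fun x => f (a + x))
    (hf.comp (contDiff_const.add contDiff_id)) (LinearIsometryEquiv.neg ℝ) z
  rw [laplacian_comp_add_left] at h1
  simpa [sub_eq_add_neg] using h1

open ContinuousLinearMap in
lemma fderiv_convolution_apply {u η : ℂ → ℝ} (hu : Continuous u) (hη : ContDiff ℝ 1 η)
    (hc : HasCompactSupport η) (x e : ℂ) :
    fderiv ℝ (convolution u η (lsmul ℝ ℝ) volume) x e =
      convolution u (fun a => fderiv ℝ η a e) (lsmul ℝ ℝ) volume x := by
  rw [(hc.hasFDerivAt_convolution_right (lsmul ℝ ℝ) hu.locallyIntegrable hη x).fderiv,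
    convolution_precompR_apply (lsmul ℝ ℝ) hu.locallyIntegrable (hc.fderiv ℝ)
      (hη.continuous_fderiv one_ne_zero)]

open ContinuousLinearMap in
lemma fderiv_fderiv_convolution_apply {u η : ℂ → ℝ} (hu : Continuous u) (hη : ContDiff ℝ ∞ η)
    (hc : HasCompactSupport η) (x e : ℂ) :
    fderiv ℝ (fderiv ℝ (convolution u η (lsmul ℝ ℝ) volume)) x e e =
      convolution u (fun a => fderiv ℝ (fderiv ℝ η) a e e) (lsmul ℝ ℝ) volume x := by
  have hη1 : ContDiff ℝ ∞ (fderiv ℝ η) := hη.fderiv_right (by norm_num)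
  have hη2 : ContDiff ℝ ∞ (fun a => fderiv ℝ η a e) := hη1.clm_apply contDiff_const
  have hc2 : HasCompactSupport (fun a => fderiv ℝ η a e) :=
    (hc.fderiv ℝ).comp_left (g := fun l : ℂ →L[ℝ] ℝ => l e) (by simp)
  have hv : ContDiff ℝ ∞ (convolution u η (lsmul ℝ ℝ) volume) :=
    hc.contDiff_convolution_right (lsmul ℝ ℝ) hu.locallyIntegrable hη
  have hv1 : ContDiff ℝ ∞ (fderiv ℝ (convolution u η (lsmul ℝ ℝ) volume)) :=
    hv.fderiv_right (by norm_num)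
  have h1 : fderiv ℝ (fun y => fderiv ℝ (convolution u η (lsmul ℝ ℝ) volume) y e) x e =
      fderiv ℝ (fderiv ℝ (convolution u η (lsmul ℝ ℝ) volume)) x e e := by
    rw [fderiv_clm_apply (hv1.differentiable (by norm_num) x) (differentiableAt_const e)]
    simp
  have h2 : ∀ a, fderiv ℝ (fun y => fderiv ℝ η y e) a e = fderiv ℝ (fderiv ℝ η) a e e :=
    fun a => by
      rw [fderiv_clm_apply (hη1.differentiable (by norm_num) a) (differentiableAt_const e)]
      simp
  rw [← h1]
  simp_rw [← h2]
  rw [← fderiv_convolution_apply hu (hη2.of_le (by exact_mod_cast le_top)) hc2]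
  congr 2
  ext y
  exact fderiv_convolution_apply hu (hη.of_le (by exact_mod_cast le_top)) hc y e

open ContinuousLinearMap in
-- All derivatives fall on the kernel, which turns the Laplacian of the mollified function into the
-- pairing of `u` with `Δ` of a test function.
lemma laplacian_convolution {u η : ℂ → ℝ} (hu : Continuous u) (hη : ContDiff ℝ ∞ η)
    (hc : HasCompactSupport η) (x : ℂ) :
    (Δ (convolution u η (lsmul ℝ ℝ) volume)) x = ∫ t, u t * (Δ η) (x - t) := by
  have hη1 : ContDiff ℝ ∞ (fderiv ℝ η) := hη.fderiv_right (by norm_num)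
  have hint : ∀ e : ℂ, Integrable fun t => u t * fderiv ℝ (fderiv ℝ η) (x - t) e e := fun e => by
    have hcont : Continuous fun a => fderiv ℝ (fderiv ℝ η) a e e :=
      ((hη1.continuous_fderiv (by norm_num)).clm_apply continuous_const).clm_apply continuous_const
    have hcs : HasCompactSupport fun a => fderiv ℝ (fderiv ℝ η) a e e :=
      ((hc.fderiv ℝ).fderiv ℝ).comp_left (g := fun l : ℂ →L[ℝ] ℂ →L[ℝ] ℝ => l e e) (by simp)
    exact (hcs.convolutionExists_right (lsmul ℝ ℝ) hu.locallyIntegrable hcont x)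
  rw [laplacian_eq_fderiv, fderiv_fderiv_convolution_apply hu hη hc,
    fderiv_fderiv_convolution_apply hu hη hc, convolution_def, convolution_def]
  simp only [lsmul_apply, smul_eq_mul]
  rw [← integral_add (hint _) (hint _)]
  congr 1
  ext t
  rw [laplacian_eq_fderiv]
  ring

open ContinuousLinearMap in
-- A mollification `v = u * η` is smooth with `Δv(x) = 2π ∫ η(x - t) dν(t) ≥ 0`, so it has the
-- submean property. Uniform closeness to `u` on the disc costs `ε / 2` at the centre and `ε / 2` in
-- the mean.
theorem IsDdc.isSubharmonic {u : ℂ → ℝ} {ν : Measure ℂ} (h : IsDdc u ν) (hu : Continuous u) :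
    IsSubharmonic u := by
  refine ⟨hu.upperSemicontinuous, fun a r hr =>
    ⟨hu.continuousOn.circleIntegrable hr.le, ?_⟩⟩
  refine le_of_forall_pos_le_add fun ε hε => ?_
  obtain ⟨δ, hδ, hδu⟩ := Metric.uniformContinuousOn_iff.mp
    ((isCompact_closedBall a (r + 1)).uniformContinuousOn_of_continuous hu.continuousOn)
    (ε / 2) (by positivity)
  -- Radius at most `1` keeps the mollifier, centred in the disc of radius `r`, inside the ball of
  -- radius `r + 1` on which `u` is uniformly continuous.
  set ρ := min δ 1 with hρ
  have hρ0 : 0 < ρ := by positivity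
  let b : ContDiffBump (0 : ℂ) := ⟨ρ / 2, ρ, by positivity, by linarith⟩
  set η : ℂ → ℝ := b.normed volume with hη
  have hηs : ContDiff ℝ ∞ η := b.contDiff_normed
  have hηc : HasCompactSupport η := b.hasCompactSupport_normed
  set v := convolution u η (lsmul ℝ ℝ) volume with hv
  have hv' : v = convolution η u (lsmul ℝ ℝ) volume := by
    rw [hv, ← convolution_flip]
    congr 1
    ext
    simp
  have hvs : ContDiff ℝ ∞ v :=
    hηc.contDiff_convolution_right (lsmul ℝ ℝ) hu.locallyIntegrable hηs
  have hΔ : ∀ x, 0 ≤ (Δ v) x := fun x => by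
    rw [laplacian_convolution hu hηs hηc]
    have hψ : ContDiff ℝ ∞ fun t => η (x - t) := hηs.comp (contDiff_const.sub contDiff_id)
    have hψc : HasCompactSupport fun t => η (x - t) :=
      hηc.comp_homeomorph (Homeomorph.subLeft x)
    have h1 := h.integral_eq _ hψ hψc
    have h2 : ∀ t, (Δ (fun t => η (x - t))) t = (Δ η) (x - t) :=
      fun t => laplacian_comp_sub (contDiff_two_of_infty hηs) x t
    simp_rw [h2] at h1
    have h3 : ∫ t, u t * (Δ η) (x - t) =
        2 * Real.pi * ∫ t, u t * (1 / (2 * Real.pi) * (Δ η) (x - t)) := by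
      rw [← integral_const_mul]
      congr 1
      ext t
      field_simp [Real.pi_pos.ne']
    rw [h3, h1]
    have := Real.pi_pos
    exact mul_nonneg (by positivity) (integral_nonneg fun t => b.nonneg_normed _)
  have hclose : ∀ x ∈ Metric.closedBall a r, dist (v x) (u x) ≤ ε / 2 := fun x hx => by
    rw [hv']
    refine ContDiffBump.dist_normed_convolution_le hu.aestronglyMeasurable fun y hy => ?_
    have hy1 : dist y x < ρ := hy
    have hx1 : dist x a ≤ r := hx
    refine (hδu y ?_ x ?_ (hy1.trans_le (min_le_left _ _))).le
    · have := dist_triangle y x a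
      have := min_le_right δ 1
      rw [Metric.mem_closedBall]
      linarith
    · rw [Metric.mem_closedBall]
      linarith
  have hsub : v a ≤ Real.circleAverage v a r := by
    have h1 := le_circleAverage_of_laplacian_nonneg (φ := fun x => v (a + x))
      ((contDiff_two_of_infty hvs).comp (contDiff_const.add contDiff_id))
      (fun z => by rw [laplacian_comp_add_left]; exact hΔ _) hr
    have h2 : Real.circleAverage (fun x => v (a + x)) 0 r = Real.circleAverage v a r := by
      simp [Real.circleAverage, circleMap]
    rwa [add_zero, h2] at h1
  have havg : Real.circleAverage v a r ≤ Real.circleAverage u a r + ε / 2 := by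
    have hc : CircleIntegrable (fun _ : ℂ => ε / 2) a r := circleIntegrable_const _ _ _
    have h1 : Real.circleAverage (u + fun _ => ε / 2) a r = Real.circleAverage u a r + ε / 2 := by
      rw [Real.circleAverage_add (hu.continuousOn.circleIntegrable hr.le) hc,
        Real.circleAverage_const]
    rw [← h1]
    refine Real.circleAverage_mono (hvs.continuous.continuousOn.circleIntegrable hr.le)
      ((hu.add continuous_const).continuousOn.circleIntegrable hr.le) fun x hx => ?_
    rw [abs_of_pos hr] at hx
    have := hclose x (Metric.sphere_subset_closedBall hx)
    rw [Real.dist_eq, abs_le] at this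
    simp only [Pi.add_apply]
    linarith
  have ha := hclose a (Metric.mem_closedBall_self hr.le)
  rw [Real.dist_eq, abs_le] at ha
  linarith

/-! ### Green's identity in the upper half-plane -/

lemma polarCoord_symm_eq (p : ℝ × ℝ) : Complex.polarCoord.symm p = polar p.1 p.2 := by
  rw [Complex.polarCoord_symm_apply, polar, Complex.exp_mul_I, Complex.ofReal_cos,
    Complex.ofReal_sin]

lemma polar_im (r θ : ℝ) : (polar r θ).im = r * Real.sin θ := by
  rw [polar, Complex.im_ofReal_mul, Complex.exp_ofReal_mul_I_im]

lemma polar_mem_upperHalf {r θ : ℝ} (hr : 0 < r) (hθ : θ ∈ Ioo (-Real.pi) Real.pi) :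
    polar r θ ∈ upperHalf ↔ θ ∈ Ioo 0 Real.pi := by
  rw [upperHalf, mem_ofPred_eq, polar_im, mul_pos_iff_of_pos_left hr]
  refine ⟨fun h => ⟨?_, hθ.2⟩, fun h => Real.sin_pos_of_mem_Ioo h⟩
  by_contra! h'
  exact absurd (Real.sin_nonpos_of_nonpos_of_neg_pi_le h' hθ.1.le) (not_le.mpr h)

lemma arg_polar {r θ : ℝ} (hr : 0 < r) (hθ : θ ∈ Ioo (-Real.pi) Real.pi) :
    (polar r θ).arg = θ := by
  rw [polar, Complex.exp_mul_I]
  exact Complex.arg_mul_cos_add_sin_mul_I hr ⟨hθ.1, hθ.2.le⟩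

lemma measurableSet_upperHalf : MeasurableSet upperHalf :=
  (isOpen_lt continuous_const Complex.continuous_im).measurableSet

lemma measurableSet_lowerHalf : MeasurableSet lowerHalf :=
  (isOpen_lt Complex.continuous_im continuous_const).measurableSet

/-- `G` absorbs the polar Jacobian and is continuous up to the boundary of the rectangle, which
justifies Fubini with no regularity asked of `F`. -/
lemma setIntegral_upperHalf_eq {F : ℂ → ℝ} {G : ℝ → ℝ → ℝ} {ρ : ℝ} (hρ : 0 ≤ ρ)
    (hF : ∀ z, ρ ≤ ‖z‖ → F z = 0) (hG : Continuous fun p : ℝ × ℝ => G p.1 p.2)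
    (hFG : ∀ r > 0, ∀ θ ∈ Ioo 0 Real.pi, r * F (polar r θ) = G r θ) :
    ∫ z in upperHalf, F z = ∫ r in (0 : ℝ)..ρ, ∫ θ in (0 : ℝ)..Real.pi, G r θ := by
  rw [← integral_indicator measurableSet_upperHalf, ← Complex.integral_comp_polarCoord_symm,
    polarCoord_target]
  have hm : MeasurableSet (Ioi (0 : ℝ) ×ˢ Ioo (-Real.pi) Real.pi) :=
    measurableSet_Ioi.prod measurableSet_Ioo
  have hm2 : MeasurableSet (Ioo (0 : ℝ) ρ ×ˢ Ioo 0 Real.pi) :=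
    measurableSet_Ioo.prod measurableSet_Ioo
  have h1 : EqOn (fun p : ℝ × ℝ => p.1 • upperHalf.indicator F (Complex.polarCoord.symm p))
      ((Ioo (0 : ℝ) ρ ×ˢ Ioo 0 Real.pi).indicator fun p => G p.1 p.2)
      (Ioi (0 : ℝ) ×ˢ Ioo (-Real.pi) Real.pi) := by
    rintro ⟨r, θ⟩ ⟨hr, hθ⟩
    have hr : 0 < r := hr
    simp only [polarCoord_symm_eq, smul_eq_mul]
    by_cases h2 : θ ∈ Ioo 0 Real.pi
    · rw [indicator_of_mem ((polar_mem_upperHalf hr hθ).mpr h2)]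
      by_cases h3 : r < ρ
      · rw [indicator_of_mem (show (r, θ) ∈ Ioo (0 : ℝ) ρ ×ˢ Ioo 0 Real.pi from ⟨⟨hr, h3⟩, h2⟩),
          hFG r hr θ h2]
      · rw [indicator_of_notMem fun h => h3 h.1.2, hF _ (by rw [norm_polar hr.le]; linarith),
          mul_zero]
    · rw [indicator_of_notMem (mt (polar_mem_upperHalf hr hθ).mp h2), mul_zero,
        indicator_of_notMem fun h => h2 h.2]
  rw [setIntegral_congr_fun hm h1, setIntegral_indicator hm2]
  have h2 : Ioi (0 : ℝ) ×ˢ Ioo (-Real.pi) Real.pi ∩ Ioo (0 : ℝ) ρ ×ˢ Ioo 0 Real.pi =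
      Ioo (0 : ℝ) ρ ×ˢ Ioo 0 Real.pi := by
    refine inter_eq_right.mpr (prod_mono Ioo_subset_Ioi_self (Ioo_subset_Ioo_left ?_))
    linarith [Real.pi_pos]
  rw [h2, Measure.volume_eq_prod, setIntegral_prod]
  · rw [intervalIntegral.integral_of_le hρ, integral_Ioc_eq_integral_Ioo]
    simp_rw [intervalIntegral.integral_of_le Real.pi_pos.le, integral_Ioc_eq_integral_Ioo]
  · exact (hG.continuousOn.integrableOn_compact (isCompact_Icc.prod isCompact_Icc)).mono_set
      (prod_mono Ioo_subset_Icc_self Ioo_subset_Icc_self)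

/-- With `D = r ∂_r`, `D (r^n (D - n) φ) = r^n (D² - n²) φ`. So the integrand is an exact
derivative, of a function vanishing at `0` through `r^n` and at `ρ` through the support of `φ`. -/
lemma integral_radial_eq_zero {φ : ℂ → ℝ} (hφ : ContDiff ℝ 2 φ) {n : ℕ} (hn : n ≠ 0) {ρ : ℝ}
    (h0 : ∀ z, ρ ≤ ‖z‖ → φ z = 0 ∧ fderiv ℝ φ z = 0) (hρ : 0 ≤ ρ) (θ : ℝ) :
    ∫ r in (0 : ℝ)..ρ, r ^ (n - 1) *
      (radialPart φ (polar r θ) - (n : ℝ) ^ 2 * φ (polar r θ)) = 0 := by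
  have hd : ∀ r, HasDerivAt
      (fun r => r ^ n * (fderiv ℝ φ (polar r θ) (polar r θ) - n * φ (polar r θ)))
      (r ^ (n - 1) * (radialPart φ (polar r θ) - (n : ℝ) ^ 2 * φ (polar r θ))) r := fun r => by
    have h1 := (hasDerivAt_pow n r).mul ((hasDerivAt_fderiv_radius hφ r θ).sub
      ((hasDerivAt_radius hφ r θ).const_mul (n : ℝ)))
    convert! h1 using 1
    have h2 : fderiv ℝ φ (polar r θ) (polar r θ) =
        r * fderiv ℝ φ (polar r θ) (Complex.exp (θ * Complex.I)) := by
      rw [← smul_eq_mul, ← map_smul]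
      simp [polar]
    have h3 : r ^ n = r ^ (n - 1) * r := by
      rw [← pow_succ]; congr 1; omega
    simp only [Pi.sub_apply]
    rw [← mul_radial_eq, h2, h3]
    ring
  have hcp : Continuous fun r => polar r θ := continuous_polar.comp (Continuous.prodMk_left θ)
  rw [intervalIntegral.integral_eq_sub_of_hasDerivAt (fun r _ => hd r)]
  · obtain ⟨h1, h2⟩ := h0 (polar ρ θ) (by rw [norm_polar hρ])
    rw [h1, h2, zero_pow hn]
    simp
  · exact Continuous.intervalIntegrable ((continuous_id.pow _).mul
      (((continuous_radialPart hφ).comp hcp).sub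
        (continuous_const.mul (hφ.continuous.comp hcp)))) _ _

/-- Green's second identity in `θ`: the integrand is the derivative of `f ∂_θφ - s φ`. Since `f`
vanishes at the ends, only the one-sided limits `E` and `-E` of `s` contribute. -/
lemma integral_angular_eq {φ : ℂ → ℝ} (hφ : ContDiff ℝ 2 φ) {f s k : ℝ → ℝ} {E : ℝ}
    (hf : Continuous f) (hk : Continuous k)
    (hfs : ∀ θ ∈ Ioo 0 Real.pi, HasDerivAt f (s θ) θ)
    (hsk : ∀ θ ∈ Ioo 0 Real.pi, HasDerivAt s (k θ) θ)
    (f0 : f 0 = 0) (fpi : f Real.pi = 0) (s0 : Tendsto s (𝓝[>] 0) (𝓝 E))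
    (spi : Tendsto s (𝓝[<] Real.pi) (𝓝 (-E))) (r : ℝ) :
    ∫ θ in (0 : ℝ)..Real.pi, (f θ * angularPart φ (polar r θ) - k θ * φ (polar r θ)) =
      E * (φ (r : ℝ) + φ (-r : ℝ)) := by
  have hcp : Continuous fun θ => polar r θ := continuous_polar.comp (Continuous.prodMk_right r)
  have hD : Continuous fun θ => fderiv ℝ φ (polar r θ) (Complex.I * polar r θ) :=
    ((contDiff_fderiv_one hφ).continuous.comp hcp).clm_apply (continuous_const.mul hcp)
  have hφc : Continuous fun θ => φ (polar r θ) := hφ.continuous.comp hcp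
  have hd : ∀ θ ∈ Ioo 0 Real.pi, HasDerivAt
      (fun θ => f θ * fderiv ℝ φ (polar r θ) (Complex.I * polar r θ) - s θ * φ (polar r θ))
      (f θ * angularPart φ (polar r θ) - k θ * φ (polar r θ)) θ := fun θ hθ => by
    convert! ((hfs θ hθ).mul (hasDerivAt_fderiv_angle hφ r θ)).sub
      ((hsk θ hθ).mul (hasDerivAt_angle hφ r θ)) using 1
    ring
  rw [intervalIntegral.integral_eq_sub_of_hasDerivAt_of_tendsto Real.pi_pos hd
    (fa := f 0 * fderiv ℝ φ (polar r 0) (Complex.I * polar r 0) - E * φ (polar r 0))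
    (fb := f Real.pi * fderiv ℝ φ (polar r Real.pi) (Complex.I * polar r Real.pi) -
      -E * φ (polar r Real.pi))]
  · rw [f0, fpi, polar_zero_right, polar_pi]
    ring
  · exact ((hf.mul ((continuous_angularPart hφ).comp hcp)).sub
      (hk.mul hφc)).intervalIntegrable _ _
  · exact ((((hf.mul hD).tendsto 0).mono_left nhdsWithin_le_nhds)).sub
      (s0.mul ((hφc.tendsto 0).mono_left nhdsWithin_le_nhds))
  · exact ((((hf.mul hD).tendsto Real.pi).mono_left nhdsWithin_le_nhds)).sub
      (spi.mul ((hφc.tendsto Real.pi).mono_left nhdsWithin_le_nhds))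

lemma integral_abs_pow_mul {n : ℕ} {ψ : ℝ → ℝ} (hψ : Continuous ψ) {ρ : ℝ} (hρ : 0 ≤ ρ)
    (h0 : ∀ x, ρ ≤ |x| → ψ x = 0) :
    ∫ x : ℝ, |x| ^ n * ψ x = ∫ r in (0 : ℝ)..ρ, r ^ n * (ψ r + ψ (-r)) := by
  have hc : Continuous fun x : ℝ => |x| ^ n * ψ x := (continuous_abs.pow n).mul hψ
  have h1 : ∫ x : ℝ, |x| ^ n * ψ x = ∫ x in (-ρ)..ρ, |x| ^ n * ψ x := by
    rw [intervalIntegral.integral_of_le (by linarith),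
      setIntegral_eq_integral_of_forall_compl_eq_zero]
    intro x hx
    rw [h0 x, mul_zero]
    by_contra! h
    rw [abs_lt] at h
    exact hx ⟨h.1, h.2.le⟩
  rw [h1, ← intervalIntegral.integral_add_adjacent_intervals (b := 0)
    (hc.intervalIntegrable _ _) (hc.intervalIntegrable _ _)]
  have h2 : ∫ x in (-ρ)..0, |x| ^ n * ψ x = ∫ x in (0 : ℝ)..ρ, |x| ^ n * ψ (-x) := by
    have := intervalIntegral.integral_comp_neg (a := 0) (b := ρ) fun x => |x| ^ n * ψ x
    simp only [abs_neg, neg_zero] at this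
    exact this.symm
  have hc' : Continuous fun x : ℝ => |x| ^ n * ψ (-x) :=
    (continuous_abs.pow n).mul (hψ.comp continuous_neg)
  rw [h2, add_comm, ← intervalIntegral.integral_add (hc.intervalIntegrable _ _)
    (hc'.intervalIntegrable _ _)]
  refine intervalIntegral.integral_congr fun x hx => ?_
  rw [uIcc_of_le hρ] at hx
  simp only [abs_of_nonneg hx.1]
  ring

theorem setIntegral_upperHalf_green {n : ℕ} (hn : 2 ≤ n) {f s g : ℝ → ℝ} {E : ℝ}
    (hf : Continuous f) (hg : Continuous g)
    (hfs : ∀ θ ∈ Ioo 0 Real.pi, HasDerivAt f (s θ) θ)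
    (hsg : ∀ θ ∈ Ioo 0 Real.pi, HasDerivAt s (g θ - (n : ℝ) ^ 2 * f θ) θ)
    (f0 : f 0 = 0) (fpi : f Real.pi = 0) (s0 : Tendsto s (𝓝[>] 0) (𝓝 E))
    (spi : Tendsto s (𝓝[<] Real.pi) (𝓝 (-E)))
    {φ : ℂ → ℝ} (hφ : ContDiff ℝ 2 φ) (hc : HasCompactSupport φ) :
    ∫ z in upperHalf, (‖z‖ ^ n * f |z.arg| * (Δ φ) z - ‖z‖ ^ (n - 2) * g |z.arg| * φ z) =
      E * ∫ x : ℝ, |x| ^ (n - 1) * φ x := by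
  obtain ⟨ρ, hρ, hball⟩ := hc.isBounded.subset_ball_lt 0 0
  have hout : ∀ z : ℂ, ρ ≤ ‖z‖ → z ∉ tsupport φ := fun z hz h => by
    have := hball h
    rw [mem_ball_zero_iff] at this
    linarith
  have h0 : ∀ z : ℂ, ρ ≤ ‖z‖ → φ z = 0 ∧ fderiv ℝ φ z = 0 := fun z hz =>
    ⟨image_eq_zero_of_notMem_tsupport (hout z hz), fderiv_of_notMem_tsupport ℝ (hout z hz)⟩
  have h0' : ∀ z : ℂ, ρ ≤ ‖z‖ → (Δ φ) z = 0 := fun z hz => by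
    rw [laplacian_eq_fderiv, fderiv_of_notMem_tsupport ℝ fun h =>
      hout z hz (tsupport_fderiv_subset ℝ h)]
    simp
  have hf2 : Continuous fun p : ℝ × ℝ => f p.2 := hf.comp continuous_snd
  have hg2 : Continuous fun p : ℝ × ℝ => g p.2 := hg.comp continuous_snd
  have hr2 : Continuous fun p : ℝ × ℝ => p.1 ^ (n - 1) := continuous_fst.pow _
  have hX1 : Continuous fun p : ℝ × ℝ => radialPart φ (polar p.1 p.2) :=
    (continuous_radialPart hφ).comp continuous_polar
  have hX2 : Continuous fun p : ℝ × ℝ => angularPart φ (polar p.1 p.2) :=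
    (continuous_angularPart hφ).comp continuous_polar
  have hφ2 : Continuous fun p : ℝ × ℝ => φ (polar p.1 p.2) := hφ.continuous.comp continuous_polar
  -- The term `n² f φ` is subtracted in `G₁` and restored in `G₂`: the first then integrates to zero
  -- in `r`, the second is Green's identity in `θ`.
  set G₁ : ℝ → ℝ → ℝ := fun r θ =>
    f θ * (r ^ (n - 1) * (radialPart φ (polar r θ) - (n : ℝ) ^ 2 * φ (polar r θ))) with hG₁
  set G₂ : ℝ → ℝ → ℝ := fun r θ => r ^ (n - 1) *
    (f θ * angularPart φ (polar r θ) - (g θ - (n : ℝ) ^ 2 * f θ) * φ (polar r θ)) with hG₂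
  have hG₁c : Continuous fun p : ℝ × ℝ => G₁ p.1 p.2 :=
    hf2.mul (hr2.mul (hX1.sub (continuous_const.mul hφ2)))
  have hG₂c : Continuous fun p : ℝ × ℝ => G₂ p.1 p.2 :=
    hr2.mul ((hf2.mul hX2).sub ((hg2.sub (continuous_const.mul hf2)).mul hφ2))
  rw [setIntegral_upperHalf_eq (G := fun r θ => G₁ r θ + G₂ r θ) hρ.le
    (fun z hz => by rw [(h0 z hz).1, h0' z hz]; simp) (hG₁c.add hG₂c)]
  · have e1 : ∀ r, ∫ θ in (0 : ℝ)..Real.pi, (G₁ r θ + G₂ r θ) =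
        (∫ θ in (0 : ℝ)..Real.pi, G₁ r θ) + ∫ θ in (0 : ℝ)..Real.pi, G₂ r θ := fun r =>
      intervalIntegral.integral_add
        ((hG₁c.comp (Continuous.prodMk_right r)).intervalIntegrable _ _)
        ((hG₂c.comp (Continuous.prodMk_right r)).intervalIntegrable _ _)
    simp_rw [e1]
    rw [intervalIntegral.integral_add
      ((intervalIntegral.continuous_parametric_intervalIntegral_of_continuous'
        hG₁c 0 Real.pi).intervalIntegrable _ _)
      ((intervalIntegral.continuous_parametric_intervalIntegral_of_continuous'
        hG₂c 0 Real.pi).intervalIntegrable _ _), intervalIntegral_swap_of_continuous hG₁c]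
    have e2 : ∀ θ, ∫ r in (0 : ℝ)..ρ, G₁ r θ = 0 := fun θ => by
      rw [hG₁, intervalIntegral.integral_const_mul,
        integral_radial_eq_zero hφ (by omega) h0 hρ.le, mul_zero]
    have e3 : ∀ r, ∫ θ in (0 : ℝ)..Real.pi, G₂ r θ =
        E * (r ^ (n - 1) * (φ (r : ℝ) + φ (-r : ℝ))) := fun r => by
      rw [hG₂, intervalIntegral.integral_const_mul, integral_angular_eq hφ hf
        (k := fun θ => g θ - (n : ℝ) ^ 2 * f θ) (hg.sub (continuous_const.mul hf)) hfs hsg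
        f0 fpi s0 spi]
      ring
    simp_rw [e2, e3]
    rw [intervalIntegral.integral_zero, zero_add, intervalIntegral.integral_const_mul,
      integral_abs_pow_mul (ψ := fun x : ℝ => φ x) (hφ.continuous.comp Complex.continuous_ofReal)
        hρ.le (fun x hx => (h0 _ (by rwa [Complex.norm_real, Real.norm_eq_abs])).1)]
  · intro r hr θ hθ
    have hθ' : θ ∈ Ioo (-Real.pi) Real.pi := ⟨by linarith [hθ.1, Real.pi_pos], hθ.2⟩
    have h1 := radialPart_add_angularPart φ (polar r θ)
    rw [norm_polar hr.le] at h1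
    rw [norm_polar hr.le, arg_polar hr hθ', abs_of_pos hθ.1]
    have h2 : r ^ n = r ^ (n - 2) * r ^ 2 := by rw [← pow_add]; congr 1; omega
    have h3 : r ^ (n - 1) = r ^ (n - 2) * r := by rw [← pow_succ]; congr 1; omega
    simp only [hG₁, hG₂]
    rw [h2, h3]
    linear_combination -(r ^ (n - 2) * r * f θ) * h1

/-! ### Homogeneous functions of the modulus and the argument -/

lemma abs_arg_conj (z : ℂ) : |(starRingEnd ℂ z).arg| = |z.arg| := by
  rw [Complex.arg_conj]
  split_ifs with h
  · rw [h]
  · rw [abs_neg]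

/-- `arg` jumps across the negative axis, but `|arg z|` is the unoriented angle between `1` and `z`,
continuous away from `0`. At `0` the factor `‖z‖ ^ n` dominates. -/
lemma continuous_norm_pow_mul_comp_abs_arg {n : ℕ} (hn : n ≠ 0) {f : ℝ → ℝ} (hf : Continuous f) :
    Continuous fun z : ℂ => ‖z‖ ^ n * f |z.arg| := by
  rw [continuous_iff_continuousAt]
  intro z
  by_cases hz : z = 0
  · subst hz
    obtain ⟨M, hM⟩ := (isCompact_Icc (a := (0 : ℝ)) (b := Real.pi)).exists_bound_of_continuousOn
      hf.continuousOn
    have hlim : Tendsto (fun z : ℂ => ‖z‖ ^ n * M) (𝓝 0) (𝓝 0) := by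
      have : Continuous fun z : ℂ => ‖z‖ ^ n * M := by fun_prop
      simpa [hn] using this.tendsto 0
    rw [ContinuousAt, norm_zero, zero_pow hn, zero_mul]
    refine squeeze_zero_norm (fun z => ?_) hlim
    rw [norm_mul, norm_pow, norm_norm]
    gcongr
    exact hM _ ⟨abs_nonneg _, Complex.abs_arg_le_pi z⟩
  · have h1 : ContinuousAt (fun z : ℂ => InnerProductGeometry.angle (1 : ℂ) z) z :=
      ContinuousAt.comp (f := fun z : ℂ => ((1 : ℂ), z))
        (InnerProductGeometry.continuousAt_angle one_ne_zero hz) (by fun_prop)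
    have h2 : ContinuousAt (fun z : ℂ => |z.arg|) z := by
      refine h1.congr ?_
      filter_upwards [isOpen_ne.mem_nhds hz] with w hw using Complex.angle_one_left hw
    exact (continuous_norm.continuousAt.pow n).mul (ContinuousAt.comp (f := fun z : ℂ => |z.arg|)
      hf.continuousAt h2)

lemma abs_arg_mem_Ioo {z : ℂ} (hz : z.im ≠ 0) : |z.arg| ∈ Ioo 0 Real.pi := by
  constructor
  · rw [abs_pos]
    intro h
    exact hz (Complex.arg_eq_zero_iff.mp h).2
  · refine lt_of_le_of_ne (Complex.abs_arg_le_pi z) fun h => ?_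
    rcases abs_choice z.arg with h1 | h1
    · rw [h1] at h
      exact hz (Complex.arg_eq_pi_iff.mp h).2
    · have := Complex.neg_pi_lt_arg z
      linarith

lemma abs_arg_notMem_Ioo {z : ℂ} (hz : z.im = 0) : |z.arg| ∉ Ioo 0 Real.pi := by
  rcases le_or_gt 0 z.re with h | h
  · rw [Complex.arg_eq_zero_iff.mpr ⟨h, hz⟩]
    simp
  · rw [Complex.arg_eq_pi_iff.mpr ⟨h, hz⟩, abs_of_pos Real.pi_pos]
    simp

lemma setIntegral_lowerHalf_eq (F : ℂ → ℝ) :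
    ∫ z in lowerHalf, F z = ∫ z in upperHalf, F (starRingEnd ℂ z) := by
  have h1 : MeasurePreserving (starRingEnd ℂ : ℂ → ℂ) volume volume :=
    Complex.conjLIE.measurePreserving
  have h2 : MeasurableEmbedding (starRingEnd ℂ : ℂ → ℂ) :=
    Complex.conjLIE.toHomeomorph.measurableEmbedding
  rw [← h1.setIntegral_preimage_emb h2 F lowerHalf]
  congr 2
  ext z
  simp [lowerHalf, upperHalf]

lemma integral_eq_upperHalf_add_lowerHalf {F : ℂ → ℝ} (hF : Integrable F)
    (h0 : ∀ z : ℂ, z.im = 0 → F z = 0) :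
    ∫ z, F z = (∫ z in upperHalf, F z) + ∫ z in lowerHalf, F z := by
  rw [← setIntegral_union _ measurableSet_lowerHalf hF.integrableOn hF.integrableOn,
    setIntegral_eq_integral_of_forall_compl_eq_zero]
  · intro z hz
    refine h0 z ?_
    simp only [upperHalf, lowerHalf, mem_union, mem_ofPred_eq, not_or, not_lt] at hz
    exact le_antisymm hz.1 hz.2
  · rw [disjoint_left]
    intro z (h1 : 0 < z.im) (h2 : z.im < 0)
    exact lt_asymm h1 h2

/-! ### The functions `H` and `H_Z` -/

/-- The continuous function on the plane that agrees with `κ` off the real axis. -/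
noncomputable def density (m : ℕ) (z : ℂ) : ℝ :=
  1 / (2 * Real.pi * c (2 * m + 3)) * (‖z‖ ^ (2 * m + 3 - 2) * angularExt m |z.arg|)

lemma continuous_density (m : ℕ) : Continuous (density m) :=
  continuous_const.mul
    (continuous_norm_pow_mul_comp_abs_arg (by omega) (continuous_angularExt m))

lemma density_nonneg (m : ℕ) (z : ℂ) : 0 ≤ density m z := by
  have h1 := c_pos m
  have h2 := angularExt_nonneg m |z.arg|
  have := Real.pi_pos
  unfold density
  positivity

lemma density_conj (m : ℕ) (z : ℂ) : density m (starRingEnd ℂ z) = density m z := by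
  rw [density, density, abs_arg_conj, Complex.norm_conj]

lemma kappa_eq_density (m : ℕ) {z : ℂ} (hz : z.im ≠ 0) : kappa (2 * m + 3) z = density m z := by
  have h1 := abs_arg_mem_Ioo hz
  rw [kappa, density, deriv_deriv_h m h1, angularExt_of_mem m h1, mul_assoc]

lemma continuous_H (m : ℕ) : Continuous (H (2 * m + 3)) := by
  have h1 : H (2 * m + 3) = fun z =>
      (c (2 * m + 3))⁻¹ * (‖z‖ ^ (2 * m + 3) * h (2 * m + 3) |z.arg|) := by
    ext z
    rw [H, mul_assoc]
  rw [h1]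
  exact continuous_const.mul (continuous_norm_pow_mul_comp_abs_arg (by omega) (continuous_h m))

lemma H_eq_zero (d : ℕ) {z : ℂ} (hz : z.im = 0) : H d z = 0 := by
  rw [H, h_eq_zero d (abs_arg_notMem_Ioo hz), mul_zero]

lemma H_conj (d : ℕ) (z : ℂ) : H d (starRingEnd ℂ z) = H d z := by
  rw [H, H, abs_arg_conj, Complex.norm_conj]

lemma HZ_eq_indicator (d : ℕ) : HZ d = lowerHalf.indicator (H d) := by
  ext z
  rcases lt_trichotomy z.im 0 with hz | hz | hz
  · rw [indicator_of_mem (show z ∈ lowerHalf from hz), HZ, if_neg (not_lt.mpr hz.le), H]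
  · rw [indicator_of_notMem (show z ∉ lowerHalf from fun h => h.ne hz), HZ, if_neg hz.not_gt]
    exact H_eq_zero d hz
  · rw [indicator_of_notMem (show z ∉ lowerHalf from fun h => lt_asymm h hz), HZ, if_pos hz]

lemma continuous_HZ (m : ℕ) : Continuous (HZ (2 * m + 3)) := by
  have h1 : Continuous fun z : ℂ => if 0 ≤ z.im then 0 else H (2 * m + 3) z :=
    Continuous.if_le continuous_const (continuous_H m) continuous_const Complex.continuous_im
      fun z hz => (H_eq_zero _ hz.symm).symm
  convert! h1 using 2 with z
  rw [HZ_eq_indicator]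
  by_cases hz : 0 ≤ z.im
  · rw [if_pos hz, indicator_of_notMem (show z ∉ lowerHalf from not_lt.mpr hz)]
  · rw [if_neg hz, indicator_of_mem (show z ∈ lowerHalf from not_le.mp hz)]

/-! ### Integrals against the measures -/

/-- Replacing `kappa` by a globally continuous, nonnegative density gives measurability and local
finiteness at once. -/
lemma muMinus_eq (m : ℕ) : muMinus (2 * m + 3) =
    (volume.restrict lowerHalf).withDensity fun z => ENNReal.ofReal (density m z) := by
  refine withDensity_congr_ae ?_
  filter_upwards [ae_restrict_mem measurableSet_lowerHalf] with z hz
  rw [kappa_eq_density m (ne_of_lt hz)]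

lemma integral_withDensity_ofReal {X : Type*} [MeasurableSpace X] {μ : Measure X} {f : X → ℝ}
    (hf : Measurable f) (h0 : ∀ x, 0 ≤ f x) (φ : X → ℝ) :
    ∫ x, φ x ∂μ.withDensity (fun x => ENNReal.ofReal (f x)) = ∫ x, f x * φ x ∂μ := by
  rw [integral_withDensity_eq_integral_toReal_smul hf.ennreal_ofReal
    (ae_of_all _ fun x => ENNReal.ofReal_lt_top)]
  simp [ENNReal.toReal_ofReal, h0]

lemma muMinus_lt_top (m : ℕ) {K : Set ℂ} (hK : IsCompact K) : muMinus (2 * m + 3) K < ⊤ := by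
  rw [muMinus_eq]
  have := IsLocallyFiniteMeasure.withDensity_ofReal (μ := volume.restrict lowerHalf)
    (continuous_density m)
  exact hK.measure_lt_top

lemma measurable_conj : Measurable (starRingEnd ℂ : ℂ → ℂ) := Complex.continuous_conj.measurable

lemma muPlus_lt_top (m : ℕ) {K : Set ℂ} (hK : IsCompact K) : muPlus (2 * m + 3) K < ⊤ := by
  rw [muPlus, Measure.map_apply measurable_conj hK.measurableSet]
  exact muMinus_lt_top m (Complex.conjLIE.toHomeomorph.isCompact_preimage.mpr hK)

lemma measurable_ofReal : Measurable ((↑) : ℝ → ℂ) := Complex.continuous_ofReal.measurable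

lemma muZero_lt_top (d : ℕ) {K : Set ℂ} (hK : IsCompact K) : muZero d K < ⊤ := by
  rw [muZero, Measure.map_apply measurable_ofReal hK.measurableSet]
  have hf : Continuous fun x : ℝ => e d / (2 * Real.pi * c d) * |x| ^ (d - 1) := by fun_prop
  have := IsLocallyFiniteMeasure.withDensity_ofReal (μ := (volume : Measure ℝ)) hf
  exact (Complex.isometry_ofReal.isClosedEmbedding.isCompact_preimage hK).measure_lt_top

lemma isLocallyFiniteMeasure_of_lt_top {ν : Measure ℂ} (h : ∀ K, IsCompact K → ν K < ⊤) :
    IsLocallyFiniteMeasure ν :=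
  ⟨fun z => ⟨Metric.closedBall z 1, Metric.closedBall_mem_nhds z one_pos,
    h _ (isCompact_closedBall z 1)⟩⟩

instance (m : ℕ) : IsLocallyFiniteMeasure (muMinus (2 * m + 3)) :=
  isLocallyFiniteMeasure_of_lt_top fun _ => muMinus_lt_top m

instance (m : ℕ) : IsLocallyFiniteMeasure (muPlus (2 * m + 3)) :=
  isLocallyFiniteMeasure_of_lt_top fun _ => muPlus_lt_top m

instance (d : ℕ) : IsLocallyFiniteMeasure (muZero d) :=
  isLocallyFiniteMeasure_of_lt_top fun _ => muZero_lt_top d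

lemma integral_muMinus (m : ℕ) (φ : ℂ → ℝ) :
    ∫ z, φ z ∂muMinus (2 * m + 3) = ∫ z in lowerHalf, density m z * φ z := by
  rw [muMinus_eq, integral_withDensity_ofReal (continuous_density m).measurable (density_nonneg m)]

lemma integral_muPlus (m : ℕ) {φ : ℂ → ℝ} (hφ : Continuous φ) :
    ∫ z, φ z ∂muPlus (2 * m + 3) = ∫ z in upperHalf, density m z * φ z := by
  rw [muPlus, integral_map measurable_conj.aemeasurable hφ.aestronglyMeasurable, integral_muMinus,
    setIntegral_lowerHalf_eq]
  simp [density_conj]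

lemma integral_muZero (m : ℕ) {φ : ℂ → ℝ} (hφ : Continuous φ) :
    ∫ z, φ z ∂muZero (2 * m + 3) = e (2 * m + 3) / (2 * Real.pi * c (2 * m + 3)) *
      ∫ x : ℝ, |x| ^ (2 * m + 3 - 1) * φ x := by
  have h1 := c_pos m
  have h2 := e_nonneg m
  have := Real.pi_pos
  rw [muZero, integral_map measurable_ofReal.aemeasurable hφ.aestronglyMeasurable,
    integral_withDensity_ofReal (Continuous.measurable (by fun_prop)) fun x => by positivity,
    ← integral_const_mul]
  simp_rw [mul_assoc]

/-! ### The distributional Laplacians -/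

lemma hasCompactSupport_laplacian {φ : ℂ → ℝ} (hc : HasCompactSupport φ) :
    HasCompactSupport (Δ φ) := by
  refine hc.mono' fun z hz => ?_
  by_contra hz'
  refine hz ?_
  rw [laplacian_eq_fderiv, fderiv_of_notMem_tsupport ℝ fun h =>
    hz' (tsupport_fderiv_subset ℝ h)]
  simp

lemma integrable_H_mul_laplacian (m : ℕ) {φ : ℂ → ℝ} (hφ : ContDiff ℝ 2 φ)
    (hc : HasCompactSupport φ) :
    Integrable fun z => H (2 * m + 3) z * (1 / (2 * Real.pi) * (Δ φ) z) :=
  ((continuous_H m).mul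
    (continuous_const.mul (continuous_laplacian hφ))).integrable_of_hasCompactSupport
      (hasCompactSupport_laplacian hc).mul_left.mul_left

/-- Green's identity with `f = h`, `g = angularExt` and `E = e_d`: one side of the real line
contributes one copy of `μ⁰`. -/
lemma integral_upperHalf_H (m : ℕ) {φ : ℂ → ℝ} (hφ : ContDiff ℝ 2 φ) (hc : HasCompactSupport φ) :
    ∫ z in upperHalf, H (2 * m + 3) z * (1 / (2 * Real.pi) * (Δ φ) z) =
      (∫ z in upperHalf, density m z * φ z) + ∫ z, φ z ∂muZero (2 * m + 3) := by
  have hcp := c_pos m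
  have hpi := Real.pi_pos
  have h1 := setIntegral_upperHalf_green (n := 2 * m + 3) (by omega) (continuous_h m)
    (continuous_angularExt m) (fun θ hθ => hasDerivAt_h m hθ)
    (fun θ hθ => by rw [angularExt_of_mem m hθ]; exact hasDerivAt_slope m hθ)
    (h_eq_zero _ (by simp)) (h_eq_zero _ (by simp)) (tendsto_slope_zero m) (tendsto_slope_pi m)
    hφ hc
  have hi1 := integrable_H_mul_laplacian m hφ hc
  have hi2 : Integrable fun z => density m z * φ z :=
    ((continuous_density m).mul hφ.continuous).integrable_of_hasCompactSupport hc.mul_left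
  rw [integral_muZero m hφ.continuous, ← sub_eq_iff_eq_add',
    ← integral_sub hi1.integrableOn hi2.integrableOn]
  have h2 : ∀ z, H (2 * m + 3) z * (1 / (2 * Real.pi) * (Δ φ) z) - density m z * φ z =
      1 / (2 * Real.pi * c (2 * m + 3)) * (‖z‖ ^ (2 * m + 3) * h (2 * m + 3) |z.arg| * (Δ φ) z -
        ‖z‖ ^ (2 * m + 3 - 2) * angularExt m |z.arg| * φ z) := fun z => by
    rw [H, density]
    field_simp
  simp_rw [h2]
  rw [integral_const_mul, h1]
  ring

/-- Apply the upper half-plane identity to `φ ∘ conj`, which agrees with `φ` on the real line, so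
the `μ⁰` term is unchanged. -/
lemma integral_lowerHalf_H (m : ℕ) {φ : ℂ → ℝ} (hφ : ContDiff ℝ 2 φ) (hc : HasCompactSupport φ) :
    ∫ z in lowerHalf, H (2 * m + 3) z * (1 / (2 * Real.pi) * (Δ φ) z) =
      (∫ z in lowerHalf, density m z * φ z) + ∫ z, φ z ∂muZero (2 * m + 3) := by
  have hψ : ContDiff ℝ 2 fun z => φ (starRingEnd ℂ z) := hφ.comp Complex.conjLIE.contDiff
  have hψc : HasCompactSupport fun z => φ (starRingEnd ℂ z) :=
    hc.comp_homeomorph Complex.conjLIE.toHomeomorph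
  have h1 := integral_upperHalf_H m hψ hψc
  have h2 : ∀ z, (Δ (fun z => φ (starRingEnd ℂ z))) z = (Δ φ) (starRingEnd ℂ z) :=
    laplacian_comp_linearIsometryEquiv hφ Complex.conjLIE
  rw [setIntegral_lowerHalf_eq, setIntegral_lowerHalf_eq]
  simp_rw [H_conj, density_conj, ← h2]
  rw [h1, integral_muZero m hψ.continuous, integral_muZero m hφ.continuous]
  simp

lemma isDdc_HZ (m : ℕ) :
    IsDdc (HZ (2 * m + 3)) (muMinus (2 * m + 3) + muZero (2 * m + 3)) where
  locallyIntegrable := (continuous_HZ m).locallyIntegrable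
  locallyFinite := isLocallyFiniteMeasure_of_lt_top fun K hK => by
    rw [Measure.add_apply]
    exact ENNReal.add_lt_top.mpr ⟨muMinus_lt_top m hK, muZero_lt_top _ hK⟩
  integral_eq φ hφ hc := by
    rw [integral_add_measure (hφ.continuous.integrable_of_hasCompactSupport hc)
      (hφ.continuous.integrable_of_hasCompactSupport hc), integral_muMinus,
      ← integral_lowerHalf_H m (contDiff_two_of_infty hφ) hc,
      ← integral_indicator measurableSet_lowerHalf, HZ_eq_indicator]
    congr 1
    ext z
    rw [indicator_mul_left]

lemma isDdc_H (m : ℕ) : IsDdc (H (2 * m + 3))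
    (muPlus (2 * m + 3) + muMinus (2 * m + 3) + (2 : ENNReal) • muZero (2 * m + 3)) where
  locallyIntegrable := (continuous_H m).locallyIntegrable
  locallyFinite := isLocallyFiniteMeasure_of_lt_top fun K hK => by
    rw [Measure.add_apply, Measure.add_apply, Measure.smul_apply]
    exact ENNReal.add_lt_top.mpr
      ⟨ENNReal.add_lt_top.mpr ⟨muPlus_lt_top m hK, muMinus_lt_top m hK⟩,
        ENNReal.mul_lt_top (by simp) (muZero_lt_top _ hK)⟩
  integral_eq φ hφ hc := by
    have hφ2 := contDiff_two_of_infty hφ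
    have hi : ∀ (ν : Measure ℂ) [IsLocallyFiniteMeasure ν], Integrable φ ν := fun ν _ =>
      hφ.continuous.integrable_of_hasCompactSupport hc
    rw [integral_add_measure ((hi _).add_measure (hi _)) ((hi _).smul_measure (by simp)),
      integral_add_measure (hi _) (hi _), integral_smul_measure, integral_muMinus,
      integral_muPlus m hφ.continuous,
      integral_eq_upperHalf_add_lowerHalf (integrable_H_mul_laplacian m hφ2 hc)
        (fun z hz => by rw [H_eq_zero _ hz, zero_mul]),
      integral_upperHalf_H m hφ2 hc, integral_lowerHalf_H m hφ2 hc]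
    simp
    ring

lemma muMZ_upperHalf (d : ℕ) : muMZ d upperHalf = 0 := by
  rw [muMZ, Measure.add_apply, muZero, muMinus,
    Measure.map_apply measurable_ofReal measurableSet_upperHalf]
  have h1 : ((↑) : ℝ → ℂ) ⁻¹' upperHalf = ∅ := by
    ext x
    simp [upperHalf]
  have h2 : (volume.restrict lowerHalf) upperHalf = 0 := by
    rw [Measure.restrict_apply measurableSet_upperHalf]
    have : upperHalf ∩ lowerHalf = ∅ := by
      ext z
      simp only [upperHalf, lowerHalf, mem_inter_iff, mem_ofPred_eq, mem_empty_iff_false, iff_false]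
      rintro ⟨h1, h2⟩
      exact lt_asymm h1 h2
    rw [this, measure_empty]
  rw [h1, measure_empty, withDensity_absolutelyContinuous _ _ h2, add_zero]

end MelroseZworski

/-! ### Assembly of the theorem, with `d = 2m + 3` -/

theorem lemma2p8 (d : ℕ) (hd : Odd d) (hd3 : 3 ≤ d) :
    -- the objects are well defined
    (∀ θ ∈ Set.Ioo (0 : ℝ) Real.pi,
      MeasureTheory.IntegrableOn (MelroseZworski.hIntegrand d θ) (Set.Ioi 0)) ∧
    IntervalIntegrable (MelroseZworski.h d) MeasureTheory.volume 0 Real.pi ∧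
    0 < MelroseZworski.c d ∧
    ContDiffOn ℝ 2 (MelroseZworski.h d) (Set.Ioo 0 Real.pi) ∧
    -- subharmonicity
    MelroseZworski.IsSubharmonic (MelroseZworski.HZ d) ∧
    MelroseZworski.IsSubharmonic (MelroseZworski.H d) ∧
    -- the density of `μ⁻` is nonnegative and locally integrable up to the boundary
    (∀ z ∈ MelroseZworski.lowerHalf, 0 ≤ MelroseZworski.kappa d z) ∧
    (∀ K : Set ℂ, IsCompact K →
      MeasureTheory.IntegrableOn (MelroseZworski.kappa d) (K ∩ MelroseZworski.lowerHalf)) ∧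
    -- the Laplacians
    MelroseZworski.IsDdc (MelroseZworski.HZ d)
      (MelroseZworski.muMinus d + MelroseZworski.muZero d) ∧
    MelroseZworski.muMinus d + MelroseZworski.muZero d = MelroseZworski.muMZ d ∧
    MelroseZworski.IsDdc (MelroseZworski.H d)
      (MelroseZworski.muPlus d + MelroseZworski.muMinus d +
        (2 : ENNReal) • MelroseZworski.muZero d) ∧
    MelroseZworski.muMZ d MelroseZworski.upperHalf = 0 := by
  obtain ⟨k, rfl⟩ := hd
  obtain ⟨m, rfl⟩ : ∃ m, k = m + 1 := ⟨k - 1, by omega⟩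
  rw [show 2 * (m + 1) + 1 = 2 * m + 3 by ring]
  have hlower : ∀ z ∈ MelroseZworski.lowerHalf, z.im ≠ 0 := fun z hz => ne_of_lt hz
  refine ⟨fun θ hθ => MelroseZworski.integrableOn_hIntegrand m hθ,
    (MelroseZworski.continuous_h m).intervalIntegrable _ _, MelroseZworski.c_pos m,
    MelroseZworski.contDiffOn_h m,
    (MelroseZworski.isDdc_HZ m).isSubharmonic (MelroseZworski.continuous_HZ m),
    (MelroseZworski.isDdc_H m).isSubharmonic (MelroseZworski.continuous_H m),
    fun z hz => ?_, fun K hK => ?_, MelroseZworski.isDdc_HZ m, ?_, MelroseZworski.isDdc_H m,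
    MelroseZworski.muMZ_upperHalf _⟩
  · rw [MelroseZworski.kappa_eq_density m (hlower z hz)]
    exact MelroseZworski.density_nonneg m z
  · refine IntegrableOn.congr_fun
      (((MelroseZworski.continuous_density m).continuousOn.integrableOn_compact hK).mono_set inter_subset_left)
      (fun z hz => (MelroseZworski.kappa_eq_density m (hlower z hz.2)).symm)
      (hK.measurableSet.inter MelroseZworski.measurableSet_lowerHalf)
  · rw [MelroseZworski.muMZ, add_comm]
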